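/- For integers $d\ge 2$ and $\ell\ge 2$, the \emph{subKautz digraph} $sK(d,\ell)$ has as vertices the words $x_1x_2\ldots x_\ell$ over $\mathbb Z_{d+1}$ with $x_i\ne x_{i+1}$ for $1\le i\le \ell-1$, and arcs $x_1x_2\ldots x_\ell\to x_2\ldots x_\ell y$ for all $y\in\mathbb Z_{d+1}$ with $y\neq x_1$ and $y\ne x_\ell$. The \emph{cyclic Kautz digraph} $CK(d,\ell)$ has as vertices the words $x_1x_2\ldots x_\ell$ over $\mathbb Z_{d+1}$ with $x_i\ne x_{i+1}$ for $1\le i\le \ell-1$ and $x_\ell\ne x_1$, and arcs $x_1x_2\ldots x_\ell\to x_2\ldots x_\ell y$ for all $y\in\mathbb Z_{d+1}$ with $y\ne x_2$ and $y\ne x_\ell$. For a finite digraph $G$, let $\delta=\delta(G)$ be the minimum of all in-degrees and out-degrees of its vertices. A set of vertices is \emph{disconnecting} if its deletion leaves a digraph that is not strongly connected or has at most one vertex; a set of arcs is \emph{disconnecting} if its deletion leaves a digraph that is not strongly connected. Let $\kappa=\kappa(G)$ and $\lambda=\lambda(G)$ be the minimum cardinalities of a disconnecting set of vertices and of a disconnecting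 set of arcs, respectively. The digraph $G$ is \emph{maximally vertex-connected} if $\kappa=\delta$. It is \emph{super-$\kappa$} if every disconnecting set of $\kappa$ vertices is the set of all vertices adjacent from some vertex of out-degree $\delta$, or the set of all vertices adjacent to some vertex of in-degree $\delta$. It is \emph{super-$\lambda$} if every disconnecting set of $\lambda$ arcs is the set of all arcs leaving some vertex of out-degree $\delta$, or the set of all arcs entering some vertex of in-degree $\delta$. \textbf{Proposition.} (i) $sK(d,\ell)$ is super-$\lambda$ whenever $d\ge 3$ and $\ell\ge 2$. (ii) $sK(d,\ell)$ is maximally vertex-connected whenever $d=\ell=3$, or $d\ge 4$ and $\ell\ge 3$. (iii) $CK(d,\ell)$ is super-$\lambda$ whenever $d\ge 3$ and $\ell\ge 3$. (iv) $CK(d,\ell)$ is super-$\kappa$ whenever $d=3$ and $\ell=4$, or $d\ge 4$ and $\ell\ge 4$. (v) $CK(d,\ell)$ is maximally vertex-connected whenever $d=3$, $\ell\ge 2$ and $\ell\ne 4$, or $d\ge 4$ and $\ell=3$. -/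

import Mathlib

namespace KautzLike

/-! ### Connectivity notions for finite digraphs -/

section Connectivity

variable {V : Type*}

/-- Every vertex can be reached from every vertex along a directed path. -/
def StronglyConnected (G : Digraph V) : Prop :=
  ∀ x y : V, Relation.ReflTransGen G.Adj x y

/-- The set `Γ⁺(v)` of vertices adjacent from `v`. -/
def outNbrs (G : Digraph V) (v : V) : Set V := {w | G.Adj v w}

/-- The set `Γ⁻(v)` of vertices adjacent to `v`. -/
def inNbrs (G : Digraph V) (v : V) : Set V := {w | G.Adj w v}

/-- The set of arcs. -/
def arcs (G : Digraph V) : Set (V × V) := {e | G.Adj e.1 e.2}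

/-- The arcs starting at `v`. -/
def outArcs (G : Digraph V) (v : V) : Set (V × V) := {e | G.Adj e.1 e.2 ∧ e.1 = v}

/-- The arcs ending at `v`. -/
def inArcs (G : Digraph V) (v : V) : Set (V × V) := {e | G.Adj e.1 e.2 ∧ e.2 = v}

/-- The out-degree of `v`. -/
noncomputable def outDeg (G : Digraph V) (v : V) : ℕ := (outNbrs G v).ncard

/-- The in-degree of `v`. -/
noncomputable def inDeg (G : Digraph V) (v : V) : ℕ := (inNbrs G v).ncard

/-- The minimum degree `δ(G)`: the minimum over all in-degrees and out-degrees. -/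
noncomputable def minDeg (G : Digraph V) : ℕ :=
  sInf {k | ∃ v, k = outDeg G v ∨ k = inDeg G v}

/-- The digraph obtained by deleting the vertices in `S`. -/
def deleteVerts (G : Digraph V) (S : Finset V) : Digraph {v : V // v ∉ S} where
  Adj u v := G.Adj u.1 v.1

/-- The digraph obtained by deleting the arcs in `S`. -/
def deleteArcs (G : Digraph V) (S : Finset (V × V)) : Digraph V where
  Adj u v := G.Adj u v ∧ (u, v) ∉ S

/-- Deleting the vertices of `S` leaves a digraph that is not strongly connected or is trivial
(has at most one vertex). -/
def IsVertexDisconnecting (G : Digraph V) (S : Finset V) : Prop :=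
  ¬ StronglyConnected (deleteVerts G S) ∨ Subsingleton {v : V // v ∉ S}

/-- `S` is a set of arcs whose deletion leaves a digraph that is not strongly connected. -/
def IsArcDisconnecting (G : Digraph V) (S : Finset (V × V)) : Prop :=
  (S : Set (V × V)) ⊆ arcs G ∧ ¬ StronglyConnected (deleteArcs G S)

/-- The (strong) vertex-connectivity `κ(G)`. -/
noncomputable def vertexConnectivity (G : Digraph V) : ℕ :=
  sInf {k | ∃ S : Finset V, IsVertexDisconnecting G S ∧ S.card = k}

/-- The (strong) arc-connectivity `λ(G)`, for a digraph with at least two vertices. -/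
noncomputable def arcConnectivity (G : Digraph V) : ℕ :=
  sInf {k | ∃ S : Finset (V × V), IsArcDisconnecting G S ∧ S.card = k}

/-- `κ(G) = δ(G)`. -/
def MaximallyVertexConnected (G : Digraph V) : Prop :=
  vertexConnectivity G = minDeg G

/-- `S` consists of all vertices adjacent from some vertex of out-degree `δ`, or of all vertices
adjacent to some vertex of in-degree `δ`. -/
def IsTrivialVertexSet (G : Digraph V) (S : Finset V) : Prop :=
  ∃ x, (outDeg G x = minDeg G ∧ (S : Set V) = outNbrs G x) ∨
    (inDeg G x = minDeg G ∧ (S : Set V) = inNbrs G x)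

/-- `S` consists of all arcs from some vertex of out-degree `δ`, or of all arcs to some vertex
of in-degree `δ`. -/
def IsTrivialArcSet (G : Digraph V) (S : Finset (V × V)) : Prop :=
  ∃ x, (outDeg G x = minDeg G ∧ (S : Set (V × V)) = outArcs G x) ∨
    (inDeg G x = minDeg G ∧ (S : Set (V × V)) = inArcs G x)

/-- Super-`κ`: every minimum vertex-disconnecting set is trivial. -/
def SuperKappa (G : Digraph V) : Prop :=
  ∀ S : Finset V, IsVertexDisconnecting G S → S.card = vertexConnectivity G →
    IsTrivialVertexSet G S

/-- Super-`λ`: every minimum arc-disconnecting set is trivial. -/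
def SuperLambda (G : Digraph V) : Prop :=
  ∀ S : Finset (V × V), IsArcDisconnecting G S → S.card = arcConnectivity G →
    IsTrivialArcSet G S

end Connectivity

/-! ### SubKautz and cyclic Kautz digraphs

The letter `x_{k+1}` of a word `x₁ x₂ … x_ℓ` is `x i` for the index `i : Fin ℓ` with `i.val = k`. -/

/-- Words `x₁ x₂ … x_ℓ` over `ℤ_{d+1}` with `x_i ≠ x_{i+1}` for `1 ≤ i < ℓ`. -/
def KautzWord (d ℓ : ℕ) : Type :=
  {x : Fin ℓ → ZMod (d + 1) // ∀ i j : Fin ℓ, i.val + 1 = j.val → x i ≠ x j}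

/-- Words `x₁ x₂ … x_ℓ` over `ℤ_{d+1}` with `x_i ≠ x_{i+1}` for `1 ≤ i < ℓ` and `x_ℓ ≠ x₁`. -/
def CyclicKautzWord (d ℓ : ℕ) : Type :=
  {x : Fin ℓ → ZMod (d + 1) // (∀ i j : Fin ℓ, i.val + 1 = j.val → x i ≠ x j) ∧
    ∀ i j : Fin ℓ, i.val = 0 → j.val + 1 = ℓ → x j ≠ x i}

/-- The subKautz digraph `sK(d,ℓ)`, for `d, ℓ ≥ 2`, with arcs
`x₁ x₂ … x_ℓ → x₂ … x_ℓ y`, where `y ≠ x₁` and `y ≠ x_ℓ`. -/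
def subKautz (d ℓ : ℕ) : Digraph (KautzWord d ℓ) where
  Adj x z := (∀ i j : Fin ℓ, i.val + 1 = j.val → z.1 i = x.1 j) ∧
    ∀ i j : Fin ℓ, i.val = 0 → j.val + 1 = ℓ → z.1 j ≠ x.1 i ∧ z.1 j ≠ x.1 j

/-- The cyclic Kautz digraph `CK(d,ℓ)`, for `d, ℓ ≥ 2`, with arcs
`x₁ x₂ … x_ℓ → x₂ … x_ℓ y`, where `y ≠ x₂` and `y ≠ x_ℓ`. -/
def cyclicKautz (d ℓ : ℕ) : Digraph (CyclicKautzWord d ℓ) where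
  Adj x z := (∀ i j : Fin ℓ, i.val + 1 = j.val → z.1 i = x.1 j) ∧
    ∀ i j : Fin ℓ, i.val = 1 → j.val + 1 = ℓ → z.1 j ≠ x.1 i ∧ z.1 j ≠ x.1 j

end KautzLike

namespace KautzLike

variable {d ℓ : ℕ}

/-! In sK(d,ℓ) a word may be followed by any letter except its first and its last, so δ = d - 1. Let
at most d - 1 arcs leave a set X of words. Super-λ amounts to X or its complement being a single
word.

If some word of X is not the tail of a leaving arc, then X contains a deep word x: no nonempty
suffix of x is a prefix of a tail (`exists_deepTo`). Every walk of length at most ℓ from x then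
stays in X. Reading words backwards gives, unless every word outside X is a head, a word y such that
walks of length at most ℓ to y stay outside X. With four or more letters, a walk from x to y of
length 2ℓ or 2ℓ + 1 can be built greedily. Length 2ℓ is absurd, since the middle word would lie on
both sides; length 2ℓ + 1 forces the middle arc into the cut, and a letter can be chosen so that it
is not there (`false_of_deepTo_arcs`). If every word of X is a tail, or every word outside is a
head, counting leaves a single word (`eq_of_forall_exit`). Sets of at most d - 2 vertices are
treated by the same walks (`false_of_deepTo_verts`).

A vertex of CK(d,m+1) is an arc of sK(d,m), from its prefix to its suffix, and CK(d,m+1) is the line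
digraph. Its vertex cuts are therefore arc cuts of sK(d,m), which settles κ
(`vertex_cut_cyclicKautz`). For λ, the tails of a nontrivial arc cut would form a trivial vertex
cut, and so would the set with one tail exchanged for its head; these two sets are incompatible. -/

instance : Finite (KautzWord d ℓ) :=
  inferInstanceAs (Finite {x : Fin ℓ → ZMod (d + 1) // ∀ i j : Fin ℓ, i.val + 1 = j.val → x i ≠ x j})

/-! ### Letters, arcs and free letters of the subKautz digraph -/

/-- The `i`-th letter of a word, counted from `0`, with the value `0` beyond the end. -/
def KautzWord.letter (v : KautzWord d ℓ) (i : ℕ) : ZMod (d + 1) :=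
  if h : i < ℓ then v.1 ⟨i, h⟩ else 0

theorem KautzWord.letter_eq (v : KautzWord d ℓ) (i : Fin ℓ) : v.1 i = v.letter i := by
  simp [KautzWord.letter]

theorem KautzWord.letter_ne (v : KautzWord d ℓ) {i : ℕ} (hi : i + 1 < ℓ) :
    v.letter i ≠ v.letter (i + 1) := by
  have := v.2 ⟨i, by omega⟩ ⟨i + 1, hi⟩ rfl
  simpa [KautzWord.letter, hi, show i < ℓ by omega] using this

theorem KautzWord.ext_letter {u v : KautzWord d ℓ} (h : ∀ i < ℓ, u.letter i = v.letter i) :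
    u = v := by
  apply Subtype.ext
  funext i
  rw [u.letter_eq, v.letter_eq, h i i.2]

/-- The word `g 0, …, g (ℓ - 1)`. -/
def KautzWord.ofFun (g : ℕ → ZMod (d + 1)) (h : ∀ i, i + 1 < ℓ → g i ≠ g (i + 1)) :
    KautzWord d ℓ :=
  ⟨fun i => g i, fun i j hij => by
    have := h i (by omega)
    rwa [hij] at this⟩

theorem KautzWord.letter_ofFun {g : ℕ → ZMod (d + 1)} (h : ∀ i, i + 1 < ℓ → g i ≠ g (i + 1))
    {i : ℕ} (hi : i < ℓ) : (KautzWord.ofFun g h).letter i = g i := by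
  simp [KautzWord.letter, KautzWord.ofFun, hi]

theorem subKautz_adj_iff (hℓ : 2 ≤ ℓ) {u v : KautzWord d ℓ} :
    (subKautz d ℓ).Adj u v ↔ (∀ i, i + 1 < ℓ → v.letter i = u.letter (i + 1)) ∧
      v.letter (ℓ - 1) ≠ u.letter 0 ∧ v.letter (ℓ - 1) ≠ u.letter (ℓ - 1) := by
  simp only [subKautz, KautzWord.letter_eq]
  constructor
  · rintro ⟨h1, h2⟩
    exact ⟨fun i hi => h1 ⟨i, by omega⟩ ⟨i + 1, hi⟩ rfl,
      h2 ⟨0, by omega⟩ ⟨ℓ - 1, by omega⟩ rfl (by simp; omega)⟩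
  · rintro ⟨h1, h2⟩
    refine ⟨fun i j hij => ?_, fun i j hi hj => ?_⟩
    · rw [h1 i (by omega), hij]
    · rw [hi, show j.val = ℓ - 1 by omega]
      exact h2

theorem subKautz_adj_letter (hℓ : 2 ≤ ℓ) {u v : KautzWord d ℓ} (h : (subKautz d ℓ).Adj u v)
    {i : ℕ} (hi : i + 1 < ℓ) : v.letter i = u.letter (i + 1) :=
  ((subKautz_adj_iff hℓ).1 h).1 i hi

theorem subKautz_adj_unique (hℓ : 2 ≤ ℓ) {u v w : KautzWord d ℓ} (hv : (subKautz d ℓ).Adj u v)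
    (hw : (subKautz d ℓ).Adj u w) (h : v.letter (ℓ - 1) = w.letter (ℓ - 1)) : v = w := by
  refine KautzWord.ext_letter fun i hi => ?_
  by_cases hi' : i + 1 < ℓ
  · rw [subKautz_adj_letter hℓ hv hi', subKautz_adj_letter hℓ hw hi']
  · rwa [show i = ℓ - 1 by omega]

theorem subKautz_exists_adj (hℓ : 2 ≤ ℓ) (u : KautzWord d ℓ) {a : ZMod (d + 1)}
    (h0 : a ≠ u.letter 0) (h1 : a ≠ u.letter (ℓ - 1)) :
    ∃ v, (subKautz d ℓ).Adj u v ∧ v.letter (ℓ - 1) = a := by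
  have hg : ∀ i, i + 1 < ℓ → (fun i => if i + 1 < ℓ then u.letter (i + 1) else a) i ≠
      (fun i => if i + 1 < ℓ then u.letter (i + 1) else a) (i + 1) := by
    intro i hi
    by_cases hi' : i + 1 + 1 < ℓ
    · simpa [hi, hi'] using u.letter_ne hi'
    · simp only [hi, hi', if_true, if_false]
      rw [show i + 1 = ℓ - 1 by omega]
      exact h1.symm
  have hlast : (KautzWord.ofFun _ hg).letter (ℓ - 1) = a := by
    rw [KautzWord.letter_ofFun hg (by omega), if_neg (by omega)]
  refine ⟨KautzWord.ofFun _ hg, (subKautz_adj_iff hℓ).2 ⟨fun i hi => ?_, ?_, ?_⟩, hlast⟩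
  · rw [KautzWord.letter_ofFun hg (by omega), if_pos hi]
  · rwa [hlast]
  · rwa [hlast]

theorem subKautz_irrefl (hℓ : 2 ≤ ℓ) (u : KautzWord d ℓ) : ¬ (subKautz d ℓ).Adj u u := fun h =>
  ((subKautz_adj_iff hℓ).1 h).2.2 rfl

/-- The letters that may follow a word in the subKautz digraph. -/
def KautzWord.free (u : KautzWord d ℓ) : Finset (ZMod (d + 1)) :=
  ({u.letter 0, u.letter (ℓ - 1)} : Finset (ZMod (d + 1)))ᶜ

theorem KautzWord.mem_free {u : KautzWord d ℓ} {a : ZMod (d + 1)} :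
    a ∈ u.free ↔ a ≠ u.letter 0 ∧ a ≠ u.letter (ℓ - 1) := by
  simp [KautzWord.free]

theorem KautzWord.card_free (u : KautzWord d ℓ) : d - 1 ≤ u.free.card := by
  rw [KautzWord.free, Finset.card_compl, ZMod.card]
  have := Finset.card_le_two (a := u.letter 0) (b := u.letter (ℓ - 1))
  omega

theorem KautzWord.card_free_of_eq (u : KautzWord d ℓ) (h : u.letter 0 = u.letter (ℓ - 1)) :
    u.free.card = d := by
  rw [KautzWord.free, Finset.card_compl, ZMod.card, h]
  simp

theorem KautzWord.card_free_of_ne (u : KautzWord d ℓ) (h : u.letter 0 ≠ u.letter (ℓ - 1)) :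
    u.free.card = d - 1 := by
  rw [KautzWord.free, Finset.card_compl, ZMod.card, Finset.card_pair h]
  omega

theorem exists_ne_ne_ne (hd : 3 ≤ d) (a b c : ZMod (d + 1)) :
    ∃ z : ZMod (d + 1), z ≠ a ∧ z ≠ b ∧ z ≠ c := by
  obtain ⟨z, hz⟩ : ∃ z, z ∉ ({a, b, c} : Finset (ZMod (d + 1))) := by
    by_contra! h
    have h1 := Finset.card_le_three (a := a) (b := b) (c := c)
    rw [Finset.eq_univ_iff_forall.2 h, Finset.card_univ, ZMod.card] at h1
    omega
  simp only [Finset.mem_insert, Finset.mem_singleton, not_or] at hz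
  exact ⟨z, hz⟩

/-- Some letter distinct from `a` and `b` is not excluded by the at most `d - 2` elements of `S`,
each of which excludes at most one letter. -/
theorem exists_ne_ne_not_excluded {α : Type*} (hd : 2 ≤ d) (S : Finset α)
    (hS : S.card ≤ d - 2) (k : α → ZMod (d + 1)) (a b : ZMod (d + 1)) :
    ∃ z, z ≠ a ∧ z ≠ b ∧ ∀ σ ∈ S, z ≠ k σ := by
  classical
  obtain ⟨z, hz⟩ : ∃ z, z ∉ ({a, b} : Finset (ZMod (d + 1))) ∪ S.image k := by
    by_contra! h
    have h1 := Finset.card_union_le ({a, b} : Finset (ZMod (d + 1))) (S.image k)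
    have h2 := Finset.card_le_two (a := a) (b := b)
    have h3 := Finset.card_image_le (s := S) (f := k)
    rw [Finset.eq_univ_iff_forall.2 h, Finset.card_univ, ZMod.card] at h1
    omega
  simp only [Finset.mem_union, Finset.mem_insert, Finset.mem_singleton, not_or,
    Finset.mem_image, not_exists, not_and] at hz
  exact ⟨z, hz.1.1, hz.1.2, fun σ hσ h => hz.2 σ hσ h.symm⟩

/-! ### Overlaps between words -/

/-- The letters of `v` from position `s` on are the first letters of `f`. -/
def Meets (v f : KautzWord d ℓ) (s : ℕ) : Prop :=
  ∀ i, s + i < ℓ → f.letter i = v.letter (s + i)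

theorem meets_zero_iff {v f : KautzWord d ℓ} : Meets v f 0 ↔ f = v := by
  constructor
  · intro h
    refine KautzWord.ext_letter fun i hi => ?_
    have := h i (by omega)
    rwa [Nat.zero_add] at this
  · rintro rfl i _
    rw [Nat.zero_add]

/-- The shift `s` plays the role of the remaining distance to `f`: a step lowers it by one, provided
that the appended letter continues `f`. -/
theorem meets_of_adj (hℓ : 2 ≤ ℓ) {u v f : KautzWord d ℓ} (h : (subKautz d ℓ).Adj u v) {s : ℕ}
    (hs : s < ℓ) : Meets v f s ↔ Meets u f (s + 1) ∧ f.letter (ℓ - 1 - s) = v.letter (ℓ - 1) := by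
  constructor
  · intro hm
    refine ⟨fun i hi => ?_, ?_⟩
    · rw [hm i (by omega), subKautz_adj_letter hℓ h (by omega)]
      congr 1; omega
    · rw [hm _ (by omega)]
      congr 1; omega
  · rintro ⟨hm, hl⟩ i hi
    by_cases hi' : s + i + 1 < ℓ
    · rw [hm i (by omega), subKautz_adj_letter hℓ h hi']
      congr 1; omega
    · rw [show s + i = ℓ - 1 by omega, ← hl]
      congr 1; omega

theorem Meets.letter_zero {v f : KautzWord d ℓ} {s : ℕ} (h : Meets v f s) (hs : s < ℓ) :
    f.letter 0 = v.letter s :=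
  h 0 (by omega)

/-- Overlaps at consecutive shifts put the first letter of `f` at two adjacent positions of `v`,
which differ. Only the empty overlap, `s + 1 = ℓ`, escapes. So the letter continuing the second
overlap is never free. -/
theorem Meets.not_succ {v f : KautzWord d ℓ} {s : ℕ} (h : Meets v f s) (hs : s < ℓ)
    (h' : Meets v f (s + 1)) : f.letter (ℓ - 1 - s) = v.letter (ℓ - 1) := by
  by_cases h1 : s + 1 < ℓ
  · exact absurd ((h.letter_zero hs).symm.trans (h'.letter_zero h1)) (v.letter_ne h1)
  · rw [show s = ℓ - 1 by omega, Nat.sub_self]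
    rw [show s = ℓ - 1 by omega] at h
    exact h.letter_zero (by omega)

/-- `v` is at distance at least `s` from every word of `T`, as far as overlaps can tell. -/
def DeepTo (T : Finset (KautzWord d ℓ)) (s : ℕ) (v : KautzWord d ℓ) : Prop :=
  ∀ f ∈ T, ∀ s' < s, ¬ Meets v f s'

/-- Appending `a` to `v` gives a word with an overlap with `f` of length `ℓ - s + 1` or `ℓ - s`. -/
def Hits (s : ℕ) (v f : KautzWord d ℓ) (a : ZMod (d + 1)) : Prop :=
  (Meets v f s ∧ f.letter (ℓ - s) = a) ∨ (Meets v f (s + 1) ∧ f.letter (ℓ - 1 - s) = a)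

/-- If the two alternatives of `Hits` occurred together, `Meets.not_succ` would make an appended
letter the last letter of `v`, which is not free. Hence a word `f` serves at most one free letter.
-/
theorem Hits.unique {s : ℕ} {v f : KautzWord d ℓ} {a b : ZMod (d + 1)} (hs : s < ℓ)
    (ha : Hits s v f a) (hb : Hits s v f b) (ha' : a ∈ v.free) (hb' : b ∈ v.free) : a = b := by
  rw [KautzWord.mem_free] at ha' hb'
  rcases ha with ⟨h1, h2⟩ | ⟨h1, h2⟩ <;> rcases hb with ⟨h3, h4⟩ | ⟨h3, h4⟩
  · exact h2.symm.trans h4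
  · exact absurd (h4.symm.trans (h1.not_succ hs h3)) hb'.2
  · exact absurd (h2.symm.trans (h3.not_succ hs h1)) ha'.2
  · exact h2.symm.trans h4

/-! ### Impossibility of a set all of whose words overlap the exits -/

/-- Every word of the set `X` has an overlap of length at least `ℓ - s` with a word of `T`, and
`X` can only be left from `T`, through at most one arc for each word of `T` if `T` has
`d - 1` words. -/
structure Stuck (X : Set (KautzWord d ℓ)) (T : Finset (KautzWord d ℓ)) (s : ℕ) : Prop where
  card_le : T.card ≤ d - 1
  closed : ∀ u ∈ X, u ∉ T → ∀ v, (subKautz d ℓ).Adj u v → v ∈ X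
  exit_unique : T.card = d - 1 → ∀ u ∈ T, ∀ v w, (subKautz d ℓ).Adj u v →
    (subKautz d ℓ).Adj u w → v ∉ X → w ∉ X → v = w
  one_le : 1 ≤ s
  lt : s < ℓ
  meets : ∀ u ∈ X, ∃ f ∈ T, ∃ s' ≤ s, Meets u f s'

namespace Stuck

variable {X : Set (KautzWord d ℓ)} {T : Finset (KautzWord d ℓ)} {s : ℕ}

/-- Depth `s ≥ 1` keeps `v` out of `T`, so the word after `a` is still in `X` and has an overlap at
shift at most `s`. Pulled back to `v`, its shift is at most `s + 1`, and depth leaves only `s` and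
`s + 1`. -/
theorem exists_hits (h : Stuck X T s) {v : KautzWord d ℓ} (hv : v ∈ X) (hvs : DeepTo T s v)
    {a : ZMod (d + 1)} (ha : a ∈ v.free) : ∃ f ∈ T, Hits s v f a := by
  have hs1 := h.one_le
  have hs := h.lt
  have hℓ : 2 ≤ ℓ := by omega
  have hvT : v ∉ T := fun hT => hvs v hT 0 (by omega) (meets_zero_iff.2 rfl)
  rw [KautzWord.mem_free] at ha
  obtain ⟨w, hw, hwa⟩ := subKautz_exists_adj hℓ v ha.1 ha.2
  obtain ⟨f, hf, s', hs', hm⟩ := h.meets w (h.closed v hv hvT w hw)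
  obtain ⟨h1, h2⟩ := (meets_of_adj hℓ hw (by omega)).1 hm
  have h3 : s ≤ s' + 1 := by
    by_contra h3
    exact hvs f hf _ (by omega) h1
  refine ⟨f, hf, ?_⟩
  obtain rfl | h4 : s' = s ∨ s = s' + 1 := by omega
  · exact Or.inr ⟨h1, h2.trans hwa⟩
  · subst h4
    exact Or.inl ⟨h1, by rw [← hwa, ← h2]; congr 1; omega⟩

/-- Pigeonhole with equality: at least `d - 1` free letters each need a word of `T`, no word serves
two of them, and `T` has at most `d - 1` words. -/
theorem bijective (h : Stuck X T s) {v : KautzWord d ℓ} (hv : v ∈ X) (hvs : DeepTo T s v) :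
    T.card = d - 1 ∧ v.free.card = d - 1 ∧ (∀ f ∈ T, ∃ a ∈ v.free, Hits s v f a) ∧
      ∀ a ∈ v.free, ∀ f ∈ T, ∀ f' ∈ T, Hits s v f a → Hits s v f' a → f = f' := by
  have : Nonempty (KautzWord d ℓ) := ⟨v⟩
  choose! F hFT hF using fun a (ha : a ∈ v.free) => h.exists_hits hv hvs ha
  have hinj : Set.InjOn F v.free := fun a ha b hb hab =>
    (hF a ha).unique h.lt (hab ▸ hF b hb) ha hb
  have hcard := Finset.card_le_card_of_injOn F hFT hinj
  have h1 := h.card_le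
  have h2 := v.card_free
  have hsurj : ∀ f ∈ T, ∃ a ∈ v.free, F a = f :=
    fun f hf => Finset.surjOn_of_injOn_of_card_le F hFT hinj (by omega) hf
  refine ⟨by omega, by omega, fun f hf => ?_, fun a ha f hf f' hf' hfa hfa' => ?_⟩
  · obtain ⟨a, ha, rfl⟩ := hsurj f hf
    exact ⟨a, ha, hF a ha⟩
  · obtain ⟨b, hb, rfl⟩ := hsurj f hf
    obtain ⟨c, hc, rfl⟩ := hsurj f' hf'
    rw [(hF b hb).unique h.lt hfa hb ha, (hF c hc).unique h.lt hfa' hc ha]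

/-- If `a` extends an overlap of length `ℓ - s` of `v`, then after appending `a` and any letter `z`
but one the overlap has length exactly `ℓ - s`. -/
theorem exists_bad (h : Stuck X T s) {v w : KautzWord d ℓ} (hv : v ∈ X) (hvs : DeepTo T s v)
    (hw : (subKautz d ℓ).Adj v w) {f : KautzWord d ℓ} (hf : f ∈ T) (hm : Meets v f s)
    (hfa : f.letter (ℓ - s) = w.letter (ℓ - 1)) :
    ∃ bad : ZMod (d + 1), ∀ z ∈ w.free, z ≠ bad →
      ∃ g ∈ T, Meets w g (s + 1) ∧ g.letter (ℓ - 1 - s) = z := by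
  have hs1 := h.one_le
  have hs := h.lt
  have hℓ : 2 ≤ ℓ := by omega
  have hvT : v ∉ T := fun hT => hvs v hT 0 (by omega) (meets_zero_iff.2 rfl)
  have hwX := h.closed v hv hvT w hw
  have ha : w.letter (ℓ - 1) ∈ v.free :=
    KautzWord.mem_free.2 ((subKautz_adj_iff hℓ).1 hw).2
  have hfa' : Hits s v f (w.letter (ℓ - 1)) := Or.inl ⟨hm, hfa⟩
  obtain ⟨hT, -, -, huniq⟩ := h.bijective hv hvs
  -- For `s ≥ 2` the word `w` is outside `T`, and the letter to avoid is the one with which `f`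
  -- continues. For `s = 1` the word `w` may be in `T`, and the letter to avoid is that of its only
  -- arc out of `X`; without such an arc any value does.
  obtain ⟨bad, hbad⟩ : ∃ bad : ZMod (d + 1), ∀ z, z ≠ bad → ∀ u, (subKautz d ℓ).Adj w u →
      u.letter (ℓ - 1) = z → u ∈ X ∧ (2 ≤ s → f.letter (ℓ - s + 1) ≠ z) := by
    by_cases hs2 : 2 ≤ s
    · have hwT : w ∉ T := fun hwT => by
        have h1 := (meets_of_adj hℓ hw (by omega)).1 (meets_zero_iff.2 (rfl : w = w))
        exact hvs w hwT 1 (by omega) h1.1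
      exact ⟨f.letter (ℓ - s + 1), fun z hz u hu _ =>
        ⟨h.closed w hwX hwT u hu, fun _ => hz.symm⟩⟩
    · by_cases hex : ∃ u, (subKautz d ℓ).Adj w u ∧ u ∉ X
      · obtain ⟨u, hu, huX⟩ := hex
        refine ⟨u.letter (ℓ - 1), fun z hz u' hu' hu'z => ⟨?_, fun h => absurd h hs2⟩⟩
        by_contra hu'X
        have hwT : w ∈ T := by
          by_contra hwT
          exact hu'X (h.closed w hwX hwT u' hu')
        rw [h.exit_unique hT w hwT u u' hu hu' huX hu'X] at hz
        exact hz hu'z.symm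
      · push Not at hex
        exact ⟨0, fun z _ u hu _ => ⟨hex u hu, fun h => absurd h hs2⟩⟩
  refine ⟨bad, fun z hz hzb => ?_⟩
  rw [KautzWord.mem_free] at hz
  obtain ⟨u, hu, huz⟩ := subKautz_exists_adj hℓ w hz.1 hz.2
  obtain ⟨huX, hchain⟩ := hbad z hzb u hu huz
  obtain ⟨g, hg, s', hs', hgm⟩ := h.meets u huX
  obtain ⟨h1, h2⟩ := (meets_of_adj hℓ hu (by omega)).1 hgm
  by_cases hss : s' = s
  · subst hss
    exact ⟨g, hg, h1, h2.trans huz⟩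
  exfalso
  obtain ⟨h3, h4⟩ := (meets_of_adj hℓ hw (by omega)).1 h1
  have h5 : s ≤ s' + 2 := by
    by_contra h5
    exact hvs g hg _ (by omega) h3
  -- In both cases `g` serves the same letter at `v` as `f`, so `g = f`. The first case makes `z`
  -- the letter continuing `f` for a second step, the second contradicts `Meets.not_succ`.
  obtain h6 | h6 : s = s' + 2 ∨ s = s' + 1 := by omega
  · subst h6
    have hga : Hits (s' + 2) v g (w.letter (ℓ - 1)) := by
      refine Or.inl ⟨h3, ?_⟩
      rw [← h4]; congr 1; omega
    have := huniq _ ha g hg f hf hga hfa'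
    subst this
    refine hchain (by omega) ?_
    rw [← huz, ← h2]; congr 1; omega
  · subst h6
    have hga : Meets v g (s' + 1 + 1) ∧ g.letter (ℓ - 1 - (s' + 1)) = w.letter (ℓ - 1) := by
      refine ⟨h3, ?_⟩
      rw [← h4]
    have := huniq _ ha g hg f hf (Or.inr hga) hfa'
    subst this
    exact (KautzWord.mem_free.1 ha).2 (hga.2.symm.trans (hm.not_succ hs hga.1))

theorem exists_free_ne (hd : 3 ≤ d) (w : KautzWord d ℓ) (bad : ZMod (d + 1)) :
    ∃ z ∈ w.free, z ≠ bad := by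
  obtain ⟨z, h1, h2, h3⟩ := exists_ne_ne_ne hd (w.letter 0) (w.letter (ℓ - 1)) bad
  exact ⟨z, KautzWord.mem_free.2 ⟨h1, h2⟩, h3⟩

/-- Appending a letter `b` that prolongs an overlap of length `ℓ - s - 1` keeps the depth. -/
theorem deepTo_of_meets_succ (h : Stuck X T s) {v w : KautzWord d ℓ} (hv : v ∈ X)
    (hvs : DeepTo T s v) (hw : (subKautz d ℓ).Adj v w) {g : KautzWord d ℓ} (hg : g ∈ T)
    (hm : Meets v g (s + 1)) (hgb : g.letter (ℓ - 1 - s) = w.letter (ℓ - 1)) :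
    w ∈ X ∧ DeepTo T s w := by
  have hs1 := h.one_le
  have hs := h.lt
  have hℓ : 2 ≤ ℓ := by omega
  have hvT : v ∉ T := fun hT => hvs v hT 0 (by omega) (meets_zero_iff.2 rfl)
  refine ⟨h.closed v hv hvT w hw, fun f hf s' hs' hfm => ?_⟩
  have hb : w.letter (ℓ - 1) ∈ v.free :=
    KautzWord.mem_free.2 ((subKautz_adj_iff hℓ).1 hw).2
  obtain ⟨h1, h2⟩ := (meets_of_adj hℓ hw (by omega)).1 hfm
  obtain h3 | h3 : s' + 1 < s ∨ s = s' + 1 := by omega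
  · exact hvs f hf _ h3 h1
  subst h3
  have hfb : Hits (s' + 1) v f (w.letter (ℓ - 1)) := by
    refine Or.inl ⟨h1, ?_⟩
    rw [← h2]; congr 1; omega
  have := (h.bijective hv hvs).2.2.2 _ hb f hf g hg hfb (Or.inr ⟨hm, hgb⟩)
  subst this
  exact (KautzWord.mem_free.1 hb).2 (hgb.symm.trans (h1.not_succ hs hm))

/-- Only one letter `a` can prolong overlaps at shift `s`, and some `f` has such an overlap. Any
other free letter `b` is served at shift `s + 1` and keeps the depth, but at the word after `b`
nothing can serve `f`. -/
theorem false_of_lt (hd : 3 ≤ d) (h : Stuck X T s) (hs2 : s + 1 < ℓ) {v : KautzWord d ℓ}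
    (hv : v ∈ X) (hvs : DeepTo T s v) : False := by
  have hs1 := h.one_le
  have hs := h.lt
  have hℓ : 2 ≤ ℓ := by omega
  obtain ⟨-, -, hsurj, huniq⟩ := h.bijective hv hvs
  -- After `a` and a letter that is not bad, some `g` overlaps `v` at shift `s + 2` and continues
  -- with `a`. Since `g` also serves a letter at `v`, it has shift `s`, which identifies `a`, or
  -- shift `s + 1`, excluded by `Meets.not_succ`.
  have key : ∀ a ∈ v.free, ∀ f ∈ T, Meets v f s → f.letter (ℓ - s) = a →
      a = v.letter (ℓ - 2) := by
    intro a ha f hf hm hfa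
    have ha' := KautzWord.mem_free.1 ha
    obtain ⟨w, hw, hwa⟩ := subKautz_exists_adj hℓ v ha'.1 ha'.2
    subst hwa
    obtain ⟨bad, hbad⟩ := h.exists_bad hv hvs hw hf hm hfa
    obtain ⟨z, hz, hzb⟩ := exists_free_ne hd w bad
    obtain ⟨g, hg, hgm, -⟩ := hbad z hz hzb
    obtain ⟨h1, h2⟩ := (meets_of_adj hℓ hw (by omega)).1 hgm
    obtain ⟨c, hc, hgc⟩ := hsurj g hg
    rcases hgc with ⟨h3, -⟩ | ⟨h3, -⟩
    · rw [← h2, h3 _ (by omega)]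
      congr 1; omega
    · exfalso
      apply ha'.2
      rw [← h2]
      exact h3.not_succ hs2 h1
  obtain ⟨f, hf, s', hs', hm⟩ := h.meets v hv
  obtain h1 | h1 : s' < s ∨ s' = s := by omega
  · exact hvs f hf s' h1 hm
  subst h1
  obtain ⟨a, ha, hfa⟩ := hsurj f hf
  have ha' := KautzWord.mem_free.1 ha
  have hfa' : a = v.letter (ℓ - 2) := by
    rcases hfa with hfa | hfa
    · exact key a ha f hf hfa.1 hfa.2
    · exact absurd (hfa.2.symm.trans (hm.not_succ hs hfa.1)) ha'.2
  obtain ⟨b, hb, hba⟩ := exists_free_ne hd v a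
  have hb' := KautzWord.mem_free.1 hb
  obtain ⟨g, hg, hgb⟩ := h.exists_hits hv hvs hb
  rcases hgb with hgb | hgb
  · exact hba ((key b hb g hg hgb.1 hgb.2).trans hfa'.symm)
  obtain ⟨w, hw, hwb⟩ := subKautz_exists_adj hℓ v hb'.1 hb'.2
  obtain ⟨hwX, hws⟩ := h.deepTo_of_meets_succ hv hvs hw hg hgb.1 (hgb.2.trans hwb.symm)
  -- Shift `s` would make `f` serve `b` at `v`, hence `f = g`. Shift `s + 1` would put `b` where `f`
  -- has `a`.
  obtain ⟨c, hc, hfc⟩ := (h.bijective hwX hws).2.2.1 f hf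
  rcases hfc with ⟨h1, -⟩ | ⟨h1, -⟩
  · obtain ⟨h2, h3⟩ := (meets_of_adj hℓ hw hs).1 h1
    have := huniq b hb f hf g hg (Or.inr ⟨h2, h3.trans hwb⟩) (Or.inr hgb)
    subst this
    exact hb'.2 (hgb.2.symm.trans (hm.not_succ hs hgb.1))
  · obtain ⟨h2, h3⟩ := (meets_of_adj hℓ hw hs2).1 h1
    apply hba
    rw [← hwb, ← h3, hfa', hm _ (by omega)]
    congr 1; omega

/-- Overlaps now have one letter or none. No word of `T` begins with the first letter of a deep
word, and a deep word always has a deep successor in `X`. Moving on, each letter of `v` becomes a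
first letter, yet the last letter of `v` begins a word of `T`. -/
theorem false_of_eq (hd : 3 ≤ d) (h : Stuck X T s) (hs2 : s + 1 = ℓ) {v : KautzWord d ℓ}
    (hv : v ∈ X) (hvs : DeepTo T s v) : False := by
  have hℓ : 2 ≤ ℓ := by have := h.one_le; omega
  have hs := h.lt
  have hsub : ℓ - 1 - s = 0 := by omega
  have hfull : ∀ v f : KautzWord d ℓ, Meets v f (s + 1) := fun v f i hi => by omega
  have hlast : ∀ v ∈ X, DeepTo T s v → ∃ f ∈ T, f.letter 0 = v.letter (ℓ - 1) := by
    intro v hv hvs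
    obtain ⟨f, hf, s', hs', hm⟩ := h.meets v hv
    obtain h1 | h1 : s' < s ∨ s' = s := by omega
    · exact absurd hm (hvs f hf s' h1)
    · refine ⟨f, hf, ?_⟩
      rw [hm.letter_zero (by omega)]
      congr 1; omega
  -- Such an `f` serves a free letter. At shift `s` this gives equal first and last letters of `v`,
  -- hence `d` free letters instead of `d - 1`; at shift `ℓ` the letter served is the first letter
  -- of `v`, which is not free.
  have hfirst : ∀ v ∈ X, DeepTo T s v → ∀ f ∈ T, f.letter 0 ≠ v.letter 0 := by
    intro v hv hvs f hf h0
    obtain ⟨-, hcard, hsurj, -⟩ := h.bijective hv hvs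
    obtain ⟨a, ha, hfa⟩ := hsurj f hf
    rcases hfa with hfa | hfa
    · have h1 := hfa.1.letter_zero hs
      rw [h0, show s = ℓ - 1 by omega] at h1
      have := v.card_free_of_eq h1
      omega
    · rw [hsub, h0] at hfa
      exact (KautzWord.mem_free.1 ha).1 hfa.2.symm
  have hnot : ∀ v ∈ X, DeepTo T s v → ∀ a ∈ v.free, ∀ f ∈ T, Meets v f s →
      f.letter (ℓ - s) = a → ∀ g ∈ T, g.letter 0 ≠ a := by
    intro v hv hvs a ha f hf hm hfa g hg hga
    have := (h.bijective hv hvs).2.2.2 a ha f hf g hg (Or.inl ⟨hm, hfa⟩)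
      (Or.inr ⟨hfull v g, by rwa [hsub]⟩)
    subst this
    have h1 := hm.letter_zero hs
    rw [hga, show s = ℓ - 1 by omega] at h1
    exact (KautzWord.mem_free.1 ha).2 h1
  -- After `a` both `b` and the first letter of `v` are free, and at most one of them is bad. The
  -- other begins a word of `T`, against `hnot` or `hfirst`.
  have hone : ∀ v ∈ X, DeepTo T s v → ∀ a ∈ v.free, ∀ b ∈ v.free, ∀ f ∈ T, ∀ g ∈ T,
      Meets v f s → f.letter (ℓ - s) = a → Meets v g s → g.letter (ℓ - s) = b →
      b ≠ v.letter 1 → b ≠ a → False := by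
    intro v hv hvs a ha b hb f hf g hg hm hfa hm' hgb hb1 hba
    have ha' := KautzWord.mem_free.1 ha
    obtain ⟨w, hw, rfl⟩ := subKautz_exists_adj hℓ v ha'.1 ha'.2
    obtain ⟨bad, hbad⟩ := h.exists_bad hv hvs hw hf hm hfa
    have hw0 : w.letter 0 = v.letter 1 := subKautz_adj_letter hℓ hw (by omega)
    have hb0 : b ∈ w.free := KautzWord.mem_free.2 ⟨by rwa [hw0], hba⟩
    have hv0 : v.letter 0 ∈ w.free :=
      KautzWord.mem_free.2 ⟨by rw [hw0]; exact v.letter_ne (by omega), ha'.1.symm⟩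
    by_cases hbb : b = bad
    · obtain ⟨k, hk, -, hk0⟩ := hbad _ hv0
        (by rw [← hbb]; exact (KautzWord.mem_free.1 hb).1.symm)
      rw [hsub] at hk0
      exact hfirst v hv hvs k hk hk0
    · obtain ⟨k, hk, -, hk0⟩ := hbad _ hb0 hbb
      rw [hsub] at hk0
      exact hnot v hv hvs b hb g hg hm' hgb k hk hk0
  have hnext : ∀ v ∈ X, DeepTo T s v →
      ∃ w ∈ X, DeepTo T s w ∧ (subKautz d ℓ).Adj v w := by
    intro v hv hvs
    obtain ⟨b, hb, g, hg, hgb⟩ : ∃ b ∈ v.free, ∃ g ∈ T, g.letter 0 = b := by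
      by_contra! hno
      have hA : ∀ a ∈ v.free, ∃ f ∈ T, Meets v f s ∧ f.letter (ℓ - s) = a := by
        intro a ha
        obtain ⟨f, hf, hfa⟩ := h.exists_hits hv hvs ha
        rcases hfa with hfa | hfa
        · exact ⟨f, hf, hfa⟩
        · exact absurd (hsub ▸ hfa.2) (hno a ha f hf)
      obtain ⟨a, ha, -⟩ := exists_free_ne hd v 0
      obtain ⟨b, hb, hba⟩ := exists_free_ne hd v a
      obtain ⟨f, hf, hfa⟩ := hA a ha
      obtain ⟨g, hg, hgb⟩ := hA b hb
      by_cases hb1 : b = v.letter 1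
      · exact hone v hv hvs b hb a ha g hg f hf hgb.1 hgb.2 hfa.1 hfa.2
          (fun h => hba (hb1.trans h.symm)) hba.symm
      · exact hone v hv hvs a ha b hb f hf g hg hfa.1 hfa.2 hgb.1 hgb.2 hb1 hba
    have hb' := KautzWord.mem_free.1 hb
    obtain ⟨w, hw, hwb⟩ := subKautz_exists_adj hℓ v hb'.1 hb'.2
    obtain ⟨h1, h2⟩ := h.deepTo_of_meets_succ hv hvs hw hg (hfull v g)
      (by rw [hsub, hgb, hwb])
    exact ⟨w, h1, h2, hw⟩
  have hall : ∀ k < ℓ, ∀ v ∈ X, DeepTo T s v → ∀ f ∈ T, f.letter 0 ≠ v.letter k := by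
    intro k
    induction k with
    | zero => exact fun _ => hfirst
    | succ k ih =>
      intro hk v hv hvs f hf
      obtain ⟨w, hwX, hws, hw⟩ := hnext v hv hvs
      rw [← subKautz_adj_letter hℓ hw hk]
      exact ih (by omega) w hwX hws f hf
  obtain ⟨f, hf, hf0⟩ := hlast v hv hvs
  exact hall _ (by omega) v hv hvs f hf hf0

end Stuck

/-- If `X` can be left only from `T`, and `T` is small, then some word of `X` has no overlap at all
with a word of `T`. -/
theorem exists_deepTo (hd : 3 ≤ d) {X : Set (KautzWord d ℓ)}
    {T : Finset (KautzWord d ℓ)} (hT : T.card ≤ d - 1)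
    (hX : ∀ u ∈ X, u ∉ T → ∀ v, (subKautz d ℓ).Adj u v → v ∈ X)
    (hexit : T.card = d - 1 → ∀ u ∈ T, ∀ v w, (subKautz d ℓ).Adj u v →
      (subKautz d ℓ).Adj u w → v ∉ X → w ∉ X → v = w)
    (h0 : ∃ u ∈ X, u ∉ T) : ∃ x ∈ X, DeepTo T ℓ x := by
  suffices H : ∀ s ≤ ℓ, ∃ x ∈ X, DeepTo T s x from H ℓ le_rfl
  intro s
  induction s with
  | zero =>
    obtain ⟨u, hu, -⟩ := h0
    exact fun _ => ⟨u, hu, fun f _ s' hs' => by omega⟩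
  | succ s ih =>
    intro hs
    rcases Nat.eq_zero_or_pos s with rfl | hs1
    · obtain ⟨u, hu, huT⟩ := h0
      refine ⟨u, hu, fun f hf s' hs' hm => huT ?_⟩
      rw [show s' = 0 by omega, meets_zero_iff] at hm
      rwa [← hm]
    · by_contra! hno
      obtain ⟨v, hv, hvs⟩ := ih (by omega)
      have hst : Stuck X T s := ⟨hT, hX, hexit, hs1, by omega, fun u hu => by
        have := hno u hu
        simp only [DeepTo] at this
        push Not at this
        obtain ⟨f, hf, s', hs', hm⟩ := this
        exact ⟨f, hf, s', by omega, hm⟩⟩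
      rcases Nat.lt_or_ge (s + 1) ℓ with h1 | h1
      · exact hst.false_of_lt hd h1 hv hvs
      · exact hst.false_of_eq hd (by omega) hv hvs

/-! ### Reversal of words -/

/-- The word read backwards. -/
def KautzWord.rev (v : KautzWord d ℓ) : KautzWord d ℓ :=
  KautzWord.ofFun (fun i => v.letter (ℓ - 1 - i)) fun i hi => by
    have := v.letter_ne (i := ℓ - 1 - (i + 1)) (by omega)
    rw [show ℓ - 1 - (i + 1) + 1 = ℓ - 1 - i by omega] at this
    exact this.symm

theorem KautzWord.letter_rev (v : KautzWord d ℓ) {i : ℕ} (hi : i < ℓ) :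
    v.rev.letter i = v.letter (ℓ - 1 - i) :=
  KautzWord.letter_ofFun _ hi

theorem KautzWord.rev_rev (v : KautzWord d ℓ) : v.rev.rev = v := by
  refine KautzWord.ext_letter fun i hi => ?_
  rw [KautzWord.letter_rev _ hi, KautzWord.letter_rev _ (by omega)]
  congr 1; omega

/-- An arc is a word of length `ℓ + 1` whose cyclically adjacent letters differ, a condition that
survives reading backwards. -/
theorem subKautz_adj_rev (hℓ : 2 ≤ ℓ) {u v : KautzWord d ℓ} (h : (subKautz d ℓ).Adj u v) :
    (subKautz d ℓ).Adj v.rev u.rev := by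
  rw [subKautz_adj_iff hℓ] at h ⊢
  obtain ⟨h1, h2, h3⟩ := h
  refine ⟨fun i hi => ?_, ?_, ?_⟩
  · rw [u.letter_rev (by omega), v.letter_rev hi, h1 _ (by omega)]
    congr 1; omega
  · rw [u.letter_rev (by omega), v.letter_rev (by omega), Nat.sub_self, Nat.sub_zero]
    exact h2.symm
  · rw [u.letter_rev (by omega), v.letter_rev (by omega), Nat.sub_self, h1 _ (by omega)]
    exact u.letter_ne (by omega)

theorem meets_rev_iff {v h : KautzWord d ℓ} {s : ℕ} : Meets v.rev h.rev s ↔ Meets h v s := by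
  constructor
  · intro hm i hi
    have := hm (ℓ - 1 - s - i) (by omega)
    rw [h.letter_rev (by omega), v.letter_rev (by omega),
      show ℓ - 1 - (ℓ - 1 - s - i) = s + i by omega,
      show ℓ - 1 - (s + (ℓ - 1 - s - i)) = i by omega] at this
    exact this.symm
  · intro hm i hi
    rw [h.letter_rev (by omega), v.letter_rev (by omega), hm _ (by omega)]
    congr 1; omega

/-- `v` has no overlap with the words of `H` preceding it. -/
def CoDeepTo (H : Finset (KautzWord d ℓ)) (s : ℕ) (v : KautzWord d ℓ) : Prop :=
  ∀ f ∈ H, ∀ s' < s, ¬ Meets f v s'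

theorem exists_coDeepTo (hd : 3 ≤ d) (hℓ : 2 ≤ ℓ) {Y : Set (KautzWord d ℓ)}
    {H : Finset (KautzWord d ℓ)} (hH : H.card ≤ d - 1)
    (hY : ∀ u ∈ Y, u ∉ H → ∀ v, (subKautz d ℓ).Adj v u → v ∈ Y)
    (hentry : H.card = d - 1 → ∀ u ∈ H, ∀ v w, (subKautz d ℓ).Adj v u →
      (subKautz d ℓ).Adj w u → v ∉ Y → w ∉ Y → v = w)
    (h0 : ∃ u ∈ Y, u ∉ H) : ∃ y ∈ Y, CoDeepTo H ℓ y := by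
  classical
  have hinj : Function.Injective (KautzWord.rev : KautzWord d ℓ → KautzWord d ℓ) :=
    Function.LeftInverse.injective KautzWord.rev_rev
  have hmem : ∀ u : KautzWord d ℓ, u ∈ H.image KautzWord.rev ↔ u.rev ∈ H := by
    intro u
    rw [← u.rev_rev, hinj.mem_finset_image, u.rev_rev]
  have hcard : (H.image KautzWord.rev).card = H.card := Finset.card_image_of_injective _ hinj
  obtain ⟨x, hx, hxd⟩ := exists_deepTo hd (X := {v | v.rev ∈ Y}) (T := H.image KautzWord.rev)
    (by rwa [hcard])
    (fun u hu huH v hv => hY _ hu (by rwa [hmem] at huH) _ (subKautz_adj_rev hℓ hv))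
    (fun hc u hu v w hv hw hvY hwY => hinj (hentry (by rwa [hcard] at hc) _ ((hmem _).1 hu) _ _
      (subKautz_adj_rev hℓ hv) (subKautz_adj_rev hℓ hw) hvY hwY))
    (by
      obtain ⟨u, hu, huH⟩ := h0
      exact ⟨u.rev, by rwa [Set.mem_ofPred_eq, u.rev_rev], by rwa [hmem, u.rev_rev]⟩)
  refine ⟨x.rev, hx, fun f hf s hs hm => hxd f.rev (by rwa [hmem, f.rev_rev]) s hs ?_⟩
  rwa [← x.rev_rev, meets_rev_iff]

/-! ### Walks -/

theorem DeepTo.of_adj (hℓ : 2 ≤ ℓ) {T : Finset (KautzWord d ℓ)} {s : ℕ} {u v : KautzWord d ℓ}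
    (h : DeepTo T (s + 1) u) (hs : s < ℓ) (huv : (subKautz d ℓ).Adj u v) : DeepTo T s v :=
  fun f hf s' hs' hm => h f hf (s' + 1) (by omega) ((meets_of_adj hℓ huv (by omega)).1 hm).1

theorem CoDeepTo.of_adj (hℓ : 2 ≤ ℓ) {H : Finset (KautzWord d ℓ)} {s : ℕ} {u v : KautzWord d ℓ}
    (h : CoDeepTo H (s + 1) v) (hs : s < ℓ) (huv : (subKautz d ℓ).Adj u v) : CoDeepTo H s u := by
  intro f hf s' hs' hm
  refine h f hf (s' + 1) (by omega) ?_
  rw [← meets_rev_iff] at hm ⊢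
  exact ((meets_of_adj hℓ (subKautz_adj_rev hℓ huv) (by omega)).1 hm).1

/-- A step lowers the depth by at most one, and a word of positive depth is outside `T`, so the walk
cannot leave `X` in its first `ℓ` steps. -/
theorem walk_mem_of_deepTo (hℓ : 2 ≤ ℓ) {X : Set (KautzWord d ℓ)} {T : Finset (KautzWord d ℓ)}
    (hX : ∀ u ∈ X, u ∉ T → ∀ v, (subKautz d ℓ).Adj u v → v ∈ X) {p : ℕ → KautzWord d ℓ} {N : ℕ}
    (hp : ∀ n < N, (subKautz d ℓ).Adj (p n) (p (n + 1))) (h0 : p 0 ∈ X)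
    (hdeep : DeepTo T ℓ (p 0)) {j : ℕ} (hj : j ≤ ℓ) (hjN : j ≤ N) : p j ∈ X := by
  suffices H : ∀ j, j ≤ ℓ → j ≤ N → p j ∈ X ∧ DeepTo T (ℓ - j) (p j) from (H j hj hjN).1
  intro j
  induction j with
  | zero => exact fun _ _ => ⟨h0, hdeep⟩
  | succ j ih =>
    intro hj hjN
    obtain ⟨h1, h2⟩ := ih (by omega) (by omega)
    have h3 : p j ∉ T := fun h => h2 _ h 0 (by omega) (meets_zero_iff.2 rfl)
    rw [show ℓ - j = ℓ - (j + 1) + 1 by omega] at h2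
    exact ⟨hX _ h1 h3 _ (hp j (by omega)), h2.of_adj hℓ (by omega) (hp j (by omega))⟩

theorem walk_mem_of_coDeepTo (hℓ : 2 ≤ ℓ) {Y : Set (KautzWord d ℓ)} {H : Finset (KautzWord d ℓ)}
    (hY : ∀ u ∈ Y, u ∉ H → ∀ v, (subKautz d ℓ).Adj v u → v ∈ Y) {p : ℕ → KautzWord d ℓ} {N : ℕ}
    (hp : ∀ n < N, (subKautz d ℓ).Adj (p n) (p (n + 1))) (h0 : p N ∈ Y)
    (hdeep : CoDeepTo H ℓ (p N)) {j : ℕ} (hj : N ≤ j + ℓ) (hjN : j ≤ N) : p j ∈ Y := by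
  suffices H : ∀ i, i ≤ ℓ → i ≤ N → p (N - i) ∈ Y ∧ CoDeepTo H (ℓ - i) (p (N - i)) by
    have := (H (N - j) (by omega) (by omega)).1
    rwa [show N - (N - j) = j by omega] at this
  intro i
  induction i with
  | zero => exact fun _ _ => ⟨h0, hdeep⟩
  | succ i ih =>
    intro hi hiN
    obtain ⟨h1, h2⟩ := ih (by omega) (by omega)
    have h3 : p (N - i) ∉ H := fun h => h2 _ h 0 (by omega) (meets_zero_iff.2 rfl)
    rw [show ℓ - i = ℓ - (i + 1) + 1 by omega] at h2
    have h4 := hp (N - (i + 1)) (by omega)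
    rw [show N - (i + 1) + 1 = N - i by omega] at h4
    exact ⟨hY _ h1 h3 _ h4, h2.of_adj hℓ (by omega) h4⟩

/-- A sequence of letters with the right inequalities yields a walk. -/
theorem exists_walk (hℓ : 2 ≤ ℓ) {g : ℕ → ZMod (d + 1)} {N : ℕ}
    (h1 : ∀ i, i + 1 < N + ℓ → g i ≠ g (i + 1)) (h2 : ∀ i < N, g i ≠ g (i + ℓ)) :
    ∃ p : ℕ → KautzWord d ℓ, (∀ n < N, (subKautz d ℓ).Adj (p n) (p (n + 1))) ∧
      ∀ n ≤ N, ∀ i < ℓ, (p n).letter i = g (n + i) := by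
  -- Truncating at `N` makes `p` total: past the end it stays at the last word.
  have hg : ∀ n i, i + 1 < ℓ →
      (fun i => g (min n N + i)) i ≠ (fun i => g (min n N + i)) (i + 1) :=
    fun n i hi => h1 (min n N + i) (by omega)
  have hl : ∀ n ≤ N, ∀ i < ℓ, (KautzWord.ofFun _ (hg n)).letter i = g (n + i) := by
    intro n hn i hi
    rw [KautzWord.letter_ofFun _ hi, min_eq_left hn]
  refine ⟨fun n => KautzWord.ofFun _ (hg n), fun n hn => ?_, hl⟩
  rw [subKautz_adj_iff hℓ]
  refine ⟨fun i hi => ?_, ?_, ?_⟩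
  · rw [hl _ (by omega) _ (by omega), hl _ (by omega) _ hi]
    congr 1; omega
  · rw [hl _ (by omega) _ (by omega), hl _ (by omega) _ (by omega)]
    have := h2 n hn
    rw [show n + ℓ = n + 1 + (ℓ - 1) by omega] at this
    exact this.symm
  · rw [hl _ (by omega) _ (by omega), hl _ (by omega) _ (by omega)]
    have := h1 (n + (ℓ - 1)) (by omega)
    rw [show n + (ℓ - 1) + 1 = n + 1 + (ℓ - 1) by omega] at this
    exact this.symm

/-- A walk from `x` to `y` through the letters `m 0, …, m (k - 1)`, where `k ≥ ℓ`. -/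
theorem exists_walk_through (hℓ : 2 ≤ ℓ) (x y : KautzWord d ℓ) {m : ℕ → ZMod (d + 1)} {k : ℕ}
    (hk : ℓ ≤ k) (h1 : m 0 ≠ x.letter (ℓ - 1)) (h2 : ∀ i, i + 1 < k → m i ≠ m (i + 1))
    (h3 : m (k - 1) ≠ y.letter 0) (h4 : ∀ i < ℓ, m i ≠ x.letter i)
    (h5 : ∀ i, i + ℓ < k → m i ≠ m (i + ℓ)) (h6 : ∀ i < ℓ, m (k - ℓ + i) ≠ y.letter i) :
    ∃ p : ℕ → KautzWord d ℓ, (∀ n < ℓ + k, (subKautz d ℓ).Adj (p n) (p (n + 1))) ∧ p 0 = x ∧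
      p (ℓ + k) = y ∧ ∀ n, n + ℓ ≤ k → ∀ i < ℓ, (p (ℓ + n)).letter i = m (n + i) := by
  set g : ℕ → ZMod (d + 1) := fun i =>
    if i < ℓ then x.letter i else if i < ℓ + k then m (i - ℓ) else y.letter (i - ℓ - k) with hg
  have gx : ∀ i < ℓ, g i = x.letter i := fun i hi => by simp only [hg, if_pos hi]
  have gm : ∀ i < k, g (ℓ + i) = m i := fun i hi => by
    simp only [hg]
    rw [if_neg (by omega), if_pos (by omega), Nat.add_sub_cancel_left]
  have gy : ∀ i, g (ℓ + k + i) = y.letter i := fun i => by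
    simp only [hg]
    rw [if_neg (by omega), if_neg (by omega)]
    congr 1; omega
  obtain ⟨p, hp, hl⟩ := exists_walk hℓ (g := g) (N := ℓ + k)
    (by
      intro i hi
      by_cases hi1 : i + 1 < ℓ
      · rw [gx i (by omega), gx _ hi1]
        exact x.letter_ne hi1
      by_cases hi2 : i < ℓ
      · have : g ℓ = m 0 := gm 0 (by omega)
        rw [gx i hi2, show i + 1 = ℓ by omega, this, show i = ℓ - 1 by omega]
        exact h1.symm
      obtain ⟨j, rfl⟩ := Nat.exists_eq_add_of_le (not_lt.1 hi2)
      by_cases hi3 : j + 1 < k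
      · rw [gm j (by omega), Nat.add_assoc, gm _ hi3]
        exact h2 j hi3
      by_cases hi4 : j < k
      · have : g (ℓ + k) = y.letter 0 := gy 0
        rw [gm j hi4, Nat.add_assoc, show j + 1 = k by omega, this, show j = k - 1 by omega]
        exact h3
      obtain ⟨t, rfl⟩ := Nat.exists_eq_add_of_le (not_lt.1 hi4)
      rw [← Nat.add_assoc, gy, Nat.add_assoc (ℓ + k), gy]
      exact y.letter_ne (by omega))
    (by
      intro i hi
      by_cases hi2 : i < ℓ
      · rw [gx i hi2, Nat.add_comm i ℓ, gm i (by omega)]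
        exact (h4 i hi2).symm
      obtain ⟨j, rfl⟩ := Nat.exists_eq_add_of_le (not_lt.1 hi2)
      by_cases hi3 : j + ℓ < k
      · rw [gm j (by omega), Nat.add_assoc, gm _ hi3]
        exact h5 j hi3
      obtain ⟨t, ht⟩ := Nat.exists_eq_add_of_le (not_lt.1 hi3)
      rw [gm j (by omega), show ℓ + j + ℓ = ℓ + k + t by omega, gy,
        show j = k - ℓ + t by omega]
      exact h6 t (by omega))
  refine ⟨p, hp, KautzWord.ext_letter fun i hi => ?_, KautzWord.ext_letter fun i hi => ?_,
    fun n hn i hi => ?_⟩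
  · rw [hl 0 (by omega) i hi, Nat.zero_add, gx i hi]
  · rw [hl _ le_rfl i hi, gy]
  · rw [hl _ (by omega) i hi, Nat.add_assoc, gm _ (by omega)]

/-! ### Greedy choices -/

theorem exists_seq_ne (hd : 3 ≤ d) (P Q : ℕ → ZMod (d + 1)) (c : ZMod (d + 1)) :
    ∃ w : ℕ → ZMod (d + 1), w 0 = c ∧
      ∀ i, w (i + 1) ≠ w i ∧ w (i + 1) ≠ P (i + 1) ∧ w (i + 1) ≠ Q (i + 1) := by
  choose f hf using fun a b c => exists_ne_ne_ne hd a b c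
  exact ⟨fun n => Nat.rec c (fun i a => f a (P (i + 1)) (Q (i + 1))) n, rfl, fun i => hf _ _ _⟩

theorem exists_seq_ne_backward (hd : 3 ≤ d) (P Q : ℕ → ZMod (d + 1)) (c : ZMod (d + 1)) (n : ℕ) :
    ∃ w : ℕ → ZMod (d + 1), w n = c ∧
      ∀ i < n, w i ≠ w (i + 1) ∧ w i ≠ P i ∧ w i ≠ Q i := by
  obtain ⟨w, hw0, hw⟩ := exists_seq_ne hd (fun i => P (n - i)) (fun i => Q (n - i)) c
  refine ⟨fun i => w (n - i), by simpa using hw0, fun i hi => ?_⟩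
  have := hw (n - (i + 1))
  rwa [show n - (i + 1) + 1 = n - i by omega, show n - (n - i) = i by omega] at this

theorem exists_walk_two_mul (hℓ : 2 ≤ ℓ) (x y : KautzWord d ℓ) {w : ℕ → ZMod (d + 1)}
    (h1 : w 0 ≠ x.letter (ℓ - 1)) (h2 : ∀ i, i + 1 < ℓ → w i ≠ w (i + 1))
    (h3 : w (ℓ - 1) ≠ y.letter 0) (h4 : ∀ i < ℓ, w i ≠ x.letter i)
    (h5 : ∀ i < ℓ, w i ≠ y.letter i) :
    ∃ p : ℕ → KautzWord d ℓ, (∀ n < ℓ + ℓ, (subKautz d ℓ).Adj (p n) (p (n + 1))) ∧ p 0 = x ∧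
      p (ℓ + ℓ) = y ∧ ∀ i < ℓ, (p ℓ).letter i = w i := by
  obtain ⟨p, hp, hx, hy, hm⟩ := exists_walk_through hℓ x y le_rfl h1 h2 h3 h4
    (fun i hi => by omega) (fun i hi => by rw [Nat.sub_self, Nat.zero_add]; exact h5 i hi)
  refine ⟨p, hp, hx, hy, fun i hi => ?_⟩
  have := hm 0 (by omega) i hi
  rwa [Nat.zero_add] at this

theorem exists_walk_two_mul_add_one (hℓ : 2 ≤ ℓ) (x y : KautzWord d ℓ) {m : ℕ → ZMod (d + 1)}
    (h1 : m 0 ≠ x.letter (ℓ - 1)) (h2 : ∀ i < ℓ, m i ≠ m (i + 1))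
    (h3 : m ℓ ≠ y.letter 0) (h4 : ∀ i < ℓ, m i ≠ x.letter i) (h5 : m 0 ≠ m ℓ)
    (h6 : ∀ i < ℓ, m (i + 1) ≠ y.letter i) :
    ∃ p : ℕ → KautzWord d ℓ, (∀ n < ℓ + (ℓ + 1), (subKautz d ℓ).Adj (p n) (p (n + 1))) ∧
      p 0 = x ∧ p (ℓ + (ℓ + 1)) = y ∧ (∀ i < ℓ, (p ℓ).letter i = m i) ∧
      ∀ i < ℓ, (p (ℓ + 1)).letter i = m (i + 1) := by
  obtain ⟨p, hp, hx, hy, hm⟩ := exists_walk_through hℓ x y (Nat.le_succ ℓ) h1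
    (fun i hi => h2 i (by omega)) h3 h4
    (fun i hi => by rw [show i = 0 by omega, Nat.zero_add]; exact h5)
    (fun i hi => by rw [show ℓ + 1 - ℓ + i = i + 1 by omega]; exact h6 i hi)
  refine ⟨p, hp, hx, hy, fun i hi => ?_, fun i hi => ?_⟩
  · have := hm 0 (by omega) i hi
    rwa [Nat.zero_add] at this
  · rw [hm 1 (by omega) i hi, Nat.add_comm 1 i]

/-- If fewer than `d` arcs leave `X`, then no word deep in `X` and no word deep in its complement
exist simultaneously. -/
theorem false_of_deepTo_arcs [DecidableEq (KautzWord d ℓ)] (hd : 3 ≤ d) (hℓ : 2 ≤ ℓ)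
    {X : Set (KautzWord d ℓ)} {F : Finset (KautzWord d ℓ × KautzWord d ℓ)} (hF : F.card ≤ d - 1)
    (hX : ∀ u ∈ X, ∀ v ∉ X, (subKautz d ℓ).Adj u v → (u, v) ∈ F) {x y : KautzWord d ℓ}
    (hx : x ∈ X) (hxd : DeepTo (F.image Prod.fst) ℓ x) (hy : y ∉ X)
    (hyd : CoDeepTo (F.image Prod.snd) ℓ y) : False := by
  have hin : ∀ u ∈ X, u ∉ F.image Prod.fst → ∀ v, (subKautz d ℓ).Adj u v → v ∈ X := by
    intro u hu huT v huv
    by_contra hv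
    exact huT (Finset.mem_image_of_mem Prod.fst (hX u hu v hv huv))
  have hout : ∀ v ∈ Xᶜ, v ∉ F.image Prod.snd → ∀ u, (subKautz d ℓ).Adj u v → u ∈ Xᶜ := by
    intro v hv hvH u huv hu
    exact hvH (Finset.mem_image_of_mem Prod.snd (hX u hu v hv huv))
  have hno : ∀ w : ℕ → ZMod (d + 1), w 0 ≠ x.letter (ℓ - 1) →
      (∀ i, i + 1 < ℓ → w i ≠ w (i + 1)) → w (ℓ - 1) ≠ y.letter 0 →
      (∀ i < ℓ, w i ≠ x.letter i) → (∀ i < ℓ, w i ≠ y.letter i) → False := by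
    intro w h1 h2 h3 h4 h5
    obtain ⟨p, hp, rfl, rfl, -⟩ := exists_walk_two_mul hℓ x y h1 h2 h3 h4 h5
    exact walk_mem_of_coDeepTo hℓ hout hp hy hyd le_rfl (by omega)
      (walk_mem_of_deepTo hℓ hin hp hx hxd le_rfl (by omega))
  -- The words number `ℓ` and `ℓ + 1` of such a walk lie on different sides, so the middle arc is in
  -- `F`.
  have hex : ∀ m : ℕ → ZMod (d + 1), m 0 ≠ x.letter (ℓ - 1) → (∀ i < ℓ, m i ≠ m (i + 1)) →
      m ℓ ≠ y.letter 0 → (∀ i < ℓ, m i ≠ x.letter i) → m 0 ≠ m ℓ →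
      (∀ i < ℓ, m (i + 1) ≠ y.letter i) → ∃ e ∈ F, ∀ i < ℓ, e.1.letter i = m i := by
    intro m h1 h2 h3 h4 h5 h6
    obtain ⟨p, hp, rfl, rfl, hm, -⟩ := exists_walk_two_mul_add_one hℓ x y h1 h2 h3 h4 h5 h6
    exact ⟨_, hX (p ℓ) (walk_mem_of_deepTo hℓ hin hp hx hxd le_rfl (by omega)) (p (ℓ + 1))
      (walk_mem_of_coDeepTo hℓ hout hp hy hyd (by omega) (by omega)) (hp ℓ (by omega)), hm⟩
  obtain ⟨n, rfl⟩ : ∃ n, ℓ = n + 2 := ⟨ℓ - 2, by omega⟩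
  simp only [show n + 2 - 1 = n + 1 by omega] at hno hex
  -- For a walk of length `2ℓ`, a forward greedy choice meets at most three exclusions per position,
  -- except four at the last: the previous letter, the last letters of `x` and `y`, and the first of
  -- `y`. The first two cases are coincidences among these. In the third, the choice runs backward,
  -- where only position `0` has four.
  by_cases h1 : y.letter 0 = x.letter (n + 1)
  · obtain ⟨c, hc0, hc1, hc2⟩ := exists_ne_ne_ne hd (x.letter 0) (x.letter (n + 1)) (y.letter 0)
    obtain ⟨w, rfl, hw⟩ := exists_seq_ne hd x.letter y.letter c
    refine hno w hc1 (fun i _ => (hw i).1.symm) (h1 ▸ (hw n).2.1) (fun i hi => ?_) fun i hi => ?_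
    · cases i with
      | zero => exact hc0
      | succ i => exact (hw i).2.1
    · cases i with
      | zero => exact hc2
      | succ i => exact (hw i).2.2
  by_cases h2 : y.letter (n + 1) = x.letter (n + 1)
  · obtain ⟨c, hc0, hc1, hc2⟩ := exists_ne_ne_ne hd (x.letter 0) (x.letter (n + 1)) (y.letter 0)
    obtain ⟨w, rfl, hw⟩ := exists_seq_ne hd x.letter
      (fun i => if i = n + 1 then y.letter 0 else y.letter i) c
    refine hno w hc1 (fun i _ => (hw i).1.symm) (by simpa using (hw n).2.2)
      (fun i hi => ?_) fun i hi => ?_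
    · cases i with
      | zero => exact hc0
      | succ i => exact (hw i).2.1
    · cases i with
      | zero => exact hc2
      | succ i =>
        by_cases hin : i = n
        · subst hin
          rw [h2]
          exact (hw i).2.1
        · simpa [hin] using (hw i).2.2
  by_cases h3 : y.letter 0 = x.letter 0
  · obtain ⟨c, hc0, hc1, hc2⟩ := exists_ne_ne_ne hd (x.letter (n + 1)) (y.letter (n + 1))
      (y.letter 0)
    obtain ⟨w, rfl, hw⟩ := exists_seq_ne_backward hd x.letter
      (fun i => if i = 0 then x.letter (n + 1) else y.letter i) c (n + 1)
    refine hno w (by simpa using (hw 0 (by omega)).2.2) (fun i hi => (hw i (by omega)).1) hc2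
      (fun i hi => ?_) fun i hi => ?_
    · by_cases hin : i = n + 1
      · rw [hin]; exact hc0
      · exact (hw i (by omega)).2.1
    · by_cases hin : i = n + 1
      · rw [hin]; exact hc1
      · by_cases hi0 : i = 0
        · rw [hi0, h3]; exact (hw 0 (by omega)).2.1
        · simpa [hi0] using (hw i (by omega)).2.2
  -- Without coincidences, take length `2ℓ + 1` and start the inserted letters with `y.letter 0`. If
  -- some tail begins otherwise, at most `d - 2` arcs remain and the second letter can avoid them.
  -- If none does, another initial letter avoids all of `F`.
  by_cases h4 : ∃ e ∈ F, e.1.letter 0 ≠ y.letter 0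
  · obtain ⟨c, hc0, hc1, hcF⟩ := exists_ne_ne_not_excluded (by omega)
      (F.filter fun e => e.1.letter 0 = y.letter 0)
      (by
        have := Finset.card_lt_card (Finset.filter_ssubset.2 h4)
        omega)
      (fun e => e.1.letter 1) (y.letter 0) (x.letter 1)
    obtain ⟨w, rfl, hw⟩ := exists_seq_ne hd y.letter
      -- The shifted letters of `x` end before position `n + 1`; there, avoiding `y.letter 0`
      -- secures both the junction with `y` and the difference between the first and last inserted
      -- letters.
      (fun i => if i = n + 1 then y.letter 0 else x.letter (i + 1)) c
    obtain ⟨e, he, hem⟩ := hex (fun i => Nat.casesOn i (y.letter 0) w) h1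
      (fun i hi => by
        cases i with
        | zero => exact hc0.symm
        | succ i => exact (hw i).1.symm)
      (by simpa using (hw n).2.2)
      (fun i hi => by
        rcases i with _ | _ | i
        · exact h3
        · exact hc1
        · have := (hw i).2.2
          rwa [if_neg (by omega)] at this)
      (by simpa using (hw n).2.2.symm)
      (fun i hi => by
        cases i with
        | zero => exact hc0
        | succ i => exact (hw i).2.1)
    exact hcF e (Finset.mem_filter.2 ⟨he, hem 0 (by omega)⟩) (hem 1 (by omega)).symm
  · push Not at h4
    obtain ⟨c, hc0, hc1, hc2⟩ := exists_ne_ne_ne hd (x.letter 0) (x.letter (n + 1)) (y.letter 0)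
    obtain ⟨w, rfl, hw⟩ := exists_seq_ne hd x.letter (fun i => y.letter (i - 1)) c
    obtain ⟨e, he, hem⟩ := hex (fun i => if i = n + 2 then x.letter (n + 1) else w i)
      (by simpa using hc1)
      (fun i hi => by
        by_cases hin : i = n + 1
        · subst hin
          simpa using (hw n).2.1
        · rw [if_neg (by omega), if_neg (by omega)]
          exact (hw i).1.symm)
      (by simpa using Ne.symm h1)
      (fun i hi => by
        rw [if_neg (by omega)]
        cases i with
        | zero => exact hc0
        | succ i => exact (hw i).2.1)
      (by simpa using hc1)
      (fun i hi => by
        by_cases hin : i = n + 1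
        · subst hin
          simpa using Ne.symm h2
        · rw [if_neg (by omega)]
          exact (hw i).2.2)
    exact hc2 ((hem 0 (by omega)).symm.trans (h4 e he))

/-- Two sets that can be left, respectively entered, only from at most `d - 2` words, in which they
must meet, cannot both have deep words. -/
theorem false_of_deepTo_verts (hd : 3 ≤ d) (hℓ : 2 ≤ ℓ) {X Y : Set (KautzWord d ℓ)}
    {S : Finset (KautzWord d ℓ)} (hS : S.card ≤ d - 2)
    (hin : ∀ u ∈ X, u ∉ S → ∀ v, (subKautz d ℓ).Adj u v → v ∈ X)
    (hout : ∀ v ∈ Y, v ∉ S → ∀ u, (subKautz d ℓ).Adj u v → u ∈ Y)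
    (hXY : ∀ u ∈ X, u ∈ Y → u ∈ S) {x y : KautzWord d ℓ}
    (hx : x ∈ X) (hxd : DeepTo S ℓ x) (hy : y ∈ Y) (hyd : CoDeepTo S ℓ y) : False := by
  have hex0 : ∀ w : ℕ → ZMod (d + 1), w 0 ≠ x.letter (ℓ - 1) →
      (∀ i, i + 1 < ℓ → w i ≠ w (i + 1)) → w (ℓ - 1) ≠ y.letter 0 →
      (∀ i < ℓ, w i ≠ x.letter i) → (∀ i < ℓ, w i ≠ y.letter i) →
      ∃ σ ∈ S, ∀ i < ℓ, σ.letter i = w i := by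
    intro w h1 h2 h3 h4 h5
    obtain ⟨p, hp, rfl, rfl, hm⟩ := exists_walk_two_mul hℓ x y h1 h2 h3 h4 h5
    exact ⟨p ℓ, hXY _ (walk_mem_of_deepTo hℓ hin hp hx hxd le_rfl (by omega))
      (walk_mem_of_coDeepTo hℓ hout hp hy hyd le_rfl (by omega)), hm⟩
  have hex1 : ∀ m : ℕ → ZMod (d + 1), m 0 ≠ x.letter (ℓ - 1) → (∀ i < ℓ, m i ≠ m (i + 1)) →
      m ℓ ≠ y.letter 0 → (∀ i < ℓ, m i ≠ x.letter i) → m 0 ≠ m ℓ →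
      (∀ i < ℓ, m (i + 1) ≠ y.letter i) →
      ∃ σ ∈ S, (∀ i < ℓ, σ.letter i = m i) ∨ ∀ i < ℓ, σ.letter i = m (i + 1) := by
    intro m h1 h2 h3 h4 h5 h6
    obtain ⟨p, hp, rfl, rfl, hm, hm'⟩ := exists_walk_two_mul_add_one hℓ x y h1 h2 h3 h4 h5 h6
    by_cases hpS : p ℓ ∈ S
    · exact ⟨_, hpS, Or.inl hm⟩
    · exact ⟨_, hXY _ (hin _ (walk_mem_of_deepTo hℓ hin hp hx hxd le_rfl (by omega)) hpS _
        (hp ℓ (by omega))) (walk_mem_of_coDeepTo hℓ hout hp hy hyd (by omega) (by omega)),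
        Or.inr hm'⟩
  obtain ⟨n, rfl⟩ : ∃ n, ℓ = n + 2 := ⟨ℓ - 2, by omega⟩
  simp only [show n + 2 - 1 = n + 1 by omega] at hex0 hex1
  by_cases h1 : y.letter 0 = x.letter (n + 1)
  · obtain ⟨c, hc0, hc1, hcS⟩ := exists_ne_ne_not_excluded (by omega) S hS
      (fun σ => σ.letter 0) (x.letter 0) (x.letter (n + 1))
    obtain ⟨w, rfl, hw⟩ := exists_seq_ne hd x.letter y.letter c
    obtain ⟨σ, hσ, hm⟩ := hex0 w hc1 (fun i _ => (hw i).1.symm) (h1 ▸ (hw n).2.1)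
      (fun i hi => by
        cases i with
        | zero => exact hc0
        | succ i => exact (hw i).2.1)
      (fun i hi => by
        cases i with
        | zero => rwa [h1]
        | succ i => exact (hw i).2.2)
    exact hcS σ hσ (hm 0 (by omega)).symm
  by_cases h3 : y.letter 0 = x.letter 0
  · by_cases h2 : y.letter (n + 1) = x.letter (n + 1)
    · obtain ⟨c, hc0, hc1, hcS⟩ := exists_ne_ne_not_excluded (by omega) S hS
        (fun σ => σ.letter 0) (x.letter 0) (x.letter (n + 1))
      obtain ⟨w, rfl, hw⟩ := exists_seq_ne hd x.letter
        (fun i => if i = n + 1 then y.letter 0 else y.letter i) c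
      obtain ⟨σ, hσ, hm⟩ := hex0 w hc1 (fun i _ => (hw i).1.symm) (by simpa using (hw n).2.2)
        (fun i hi => by
          cases i with
          | zero => exact hc0
          | succ i => exact (hw i).2.1)
        (fun i hi => by
          cases i with
          | zero => rwa [h3]
          | succ i =>
            by_cases hin : i = n
            · subst hin
              rw [h2]
              exact (hw i).2.1
            · simpa [hin] using (hw i).2.2)
      exact hcS σ hσ (hm 0 (by omega)).symm
    -- The two middle words end in `c` and in `c` followed by `x.letter (n + 1)`. As `c` differs
    -- from the latter, an element of `S` rules out only one value of `c`.
    · obtain ⟨c, hc0, hc1, hcS⟩ := exists_ne_ne_not_excluded (by omega) S hS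
        (fun σ => if σ.letter (n + 1) = x.letter (n + 1) then σ.letter n else σ.letter (n + 1))
        (x.letter (n + 1)) (y.letter n)
      obtain ⟨w, rfl, hw⟩ := exists_seq_ne_backward hd x.letter
        (fun i => if i = 0 then x.letter (n + 1) else y.letter (i - 1)) c (n + 1)
      obtain ⟨σ, hσ, hm⟩ := hex1 (fun i => if i = n + 2 then x.letter (n + 1) else w i)
        (by simpa using (hw 0 (by omega)).2.2)
        (fun i hi => by
          by_cases hin : i = n + 1
          · subst hin
            simpa using hc0
          · rw [if_neg (by omega), if_neg (by omega)]
            exact (hw i (by omega)).1)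
        (by simpa using Ne.symm h1)
        (fun i hi => by
          rw [if_neg (by omega)]
          by_cases hin : i = n + 1
          · subst hin; exact hc0
          · exact (hw i (by omega)).2.1)
        (by simpa using (hw 0 (by omega)).2.2)
        (fun i hi => by
          by_cases hin : i = n + 1
          · subst hin
            simpa using Ne.symm h2
          · rw [if_neg (by omega)]
            by_cases hin' : i = n
            · subst hin'; exact hc1
            · simpa using (hw (i + 1) (by omega)).2.2)
      rcases hm with hm | hm
      · have := hcS σ hσ
        have h5 := hm (n + 1) (by omega)
        rw [if_neg (by omega)] at h5
        rw [h5, if_neg hc0] at this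
        exact this rfl
      · have := hcS σ hσ
        have h5 := hm (n + 1) (by omega)
        have h6 := hm n (by omega)
        rw [if_pos rfl] at h5
        rw [if_neg (by omega)] at h6
        rw [h5, if_pos rfl, h6] at this
        exact this rfl
  -- The two middle words begin with `y.letter 0` followed by `c`, and with `c`; again each element
  -- of `S` rules out one value.
  · obtain ⟨c, hc0, hc1, hcS⟩ := exists_ne_ne_not_excluded (by omega) S hS
      (fun σ => if σ.letter 0 = y.letter 0 then σ.letter 1 else σ.letter 0)
      (y.letter 0) (x.letter 1)
    obtain ⟨w, rfl, hw⟩ := exists_seq_ne hd y.letter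
      (fun i => if i = n + 1 then y.letter 0 else x.letter (i + 1)) c
    obtain ⟨σ, hσ, hm⟩ := hex1 (fun i => Nat.casesOn i (y.letter 0) w) h1
      (fun i hi => by
        cases i with
        | zero => exact hc0.symm
        | succ i => exact (hw i).1.symm)
      (by simpa using (hw n).2.2)
      (fun i hi => by
        rcases i with _ | _ | i
        · exact h3
        · exact hc1
        · have := (hw i).2.2
          rwa [if_neg (by omega)] at this)
      (by simpa using (hw n).2.2.symm)
      (fun i hi => by
        cases i with
        | zero => exact hc0
        | succ i => exact (hw i).2.1)
    have := hcS σ hσ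
    rcases hm with hm | hm
    · rw [if_pos (show σ.letter 0 = y.letter 0 from hm 0 (by omega))] at this
      exact this (hm 1 (by omega)).symm
    · have h5 : σ.letter 0 = w 0 := hm 0 (by omega)
      rw [h5, if_neg hc0] at this
      exact this rfl

/-! ### Bounds on the connectivities by the minimum degree -/

section General

variable {V : Type*} {G : Digraph V}

theorem ncard_outArcs (G : Digraph V) (v : V) : (outArcs G v).ncard = outDeg G v := by
  have : outArcs G v = Prod.mk v '' outNbrs G v := by
    ext ⟨a, b⟩
    simp only [outArcs, outNbrs, Set.mem_ofPred_eq, Set.mem_image, Prod.mk.injEq]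
    constructor
    · rintro ⟨h, rfl⟩
      exact ⟨b, h, rfl, rfl⟩
    · rintro ⟨_, h, rfl, rfl⟩
      exact ⟨h, rfl⟩
  rw [this, Set.ncard_image_of_injective _ (Prod.mk_right_injective v), outDeg]

theorem ncard_inArcs (G : Digraph V) (v : V) : (inArcs G v).ncard = inDeg G v := by
  have : inArcs G v = (fun u => (u, v)) '' inNbrs G v := by
    ext ⟨a, b⟩
    simp only [inArcs, inNbrs, Set.mem_ofPred_eq, Set.mem_image, Prod.mk.injEq]
    constructor
    · rintro ⟨h, rfl⟩
      exact ⟨a, h, rfl, rfl⟩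
    · rintro ⟨_, h, rfl, rfl⟩
      exact ⟨h, rfl⟩
  rw [this, Set.ncard_image_of_injective _ (Prod.mk_left_injective v), inDeg]

theorem minDeg_eq [Nonempty V] {k : ℕ} (hout : ∀ v, k ≤ outDeg G v) (hin : ∀ v, k ≤ inDeg G v)
    (h : ∃ v, outDeg G v = k) : minDeg G = k := by
  obtain ⟨v, hv⟩ := h
  refine le_antisymm (Nat.sInf_le ⟨v, Or.inl hv.symm⟩) (le_csInf ⟨k, v, Or.inl hv.symm⟩ ?_)
  rintro _ ⟨w, rfl | rfl⟩
  · exact hout w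
  · exact hin w

theorem exists_deg_eq_minDeg [Nonempty V] (G : Digraph V) :
    ∃ v, minDeg G = outDeg G v ∨ minDeg G = inDeg G v :=
  Nat.sInf_mem (s := {k | ∃ v, k = outDeg G v ∨ k = inDeg G v})
    ⟨_, Classical.arbitrary V, Or.inl rfl⟩

theorem not_reflTransGen_of_forall_not {r : V → V → Prop} {a b : V} (hab : a ≠ b)
    (h : (∀ c, ¬ r a c) ∨ ∀ c, ¬ r c b) : ¬ Relation.ReflTransGen r a b := by
  intro hr
  rcases h with h | h
  · obtain rfl | ⟨c, hc, -⟩ := hr.cases_head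
    · exact hab rfl
    · exact h c hc
  · obtain rfl | ⟨c, -, hc⟩ := hr.cases_tail
    · exact hab rfl
    · exact h c hc

theorem arcConnectivity_le_minDeg [Finite V] [Nontrivial V] (G : Digraph V) :
    arcConnectivity G ≤ minDeg G := by
  obtain ⟨v, hv⟩ := exists_deg_eq_minDeg G
  obtain ⟨w, hw⟩ := exists_ne v
  rcases hv with hv | hv <;> rw [hv]
  · have hfin := (outArcs G v).toFinite
    refine Nat.sInf_le ⟨hfin.toFinset, ⟨?_, fun h => ?_⟩, ?_⟩
    · rw [hfin.coe_toFinset]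
      exact fun e he => he.1
    · refine not_reflTransGen_of_forall_not hw.symm (Or.inl ?_) (h v w)
      rintro c ⟨hc, hc'⟩
      exact hc' (hfin.mem_toFinset.2 ⟨hc, rfl⟩)
    · rw [← Set.ncard_eq_toFinset_card _ hfin, ncard_outArcs]
  · have hfin := (inArcs G v).toFinite
    refine Nat.sInf_le ⟨hfin.toFinset, ⟨?_, fun h => ?_⟩, ?_⟩
    · rw [hfin.coe_toFinset]
      exact fun e he => he.1
    · refine not_reflTransGen_of_forall_not hw (Or.inr ?_) (h w v)
      rintro c ⟨hc, hc'⟩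
      exact hc' (hfin.mem_toFinset.2 ⟨hc, rfl⟩)
    · rw [← Set.ncard_eq_toFinset_card _ hfin, ncard_inArcs]

theorem vertexConnectivity_le_minDeg [Finite V] [Nonempty V] (hG : ∀ v, ¬ G.Adj v v) :
    vertexConnectivity G ≤ minDeg G := by
  obtain ⟨v, hv⟩ := exists_deg_eq_minDeg G
  rcases hv with hv | hv <;> rw [hv]
  · have hfin := (outNbrs G v).toFinite
    refine Nat.sInf_le ⟨hfin.toFinset, ?_, (Set.ncard_eq_toFinset_card _ hfin).symm⟩
    by_cases hs : Subsingleton {w : V // w ∉ hfin.toFinset}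
    · exact Or.inr hs
    rw [not_subsingleton_iff_nontrivial] at hs
    have hvS : v ∉ hfin.toFinset := fun h => hG v (hfin.mem_toFinset.1 h)
    obtain ⟨w, hw⟩ := exists_ne (⟨v, hvS⟩ : {w : V // w ∉ hfin.toFinset})
    refine Or.inl fun h => not_reflTransGen_of_forall_not hw.symm (Or.inl fun c hc => ?_) (h _ w)
    exact c.2 (hfin.mem_toFinset.2 hc)
  · have hfin := (inNbrs G v).toFinite
    refine Nat.sInf_le ⟨hfin.toFinset, ?_, (Set.ncard_eq_toFinset_card _ hfin).symm⟩
    by_cases hs : Subsingleton {w : V // w ∉ hfin.toFinset}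
    · exact Or.inr hs
    rw [not_subsingleton_iff_nontrivial] at hs
    have hvS : v ∉ hfin.toFinset := fun h => hG v (hfin.mem_toFinset.1 h)
    obtain ⟨w, hw⟩ := exists_ne (⟨v, hvS⟩ : {w : V // w ∉ hfin.toFinset})
    refine Or.inl fun h => not_reflTransGen_of_forall_not hw (Or.inr fun c hc => ?_) (h w _)
    exact c.2 (hfin.mem_toFinset.2 hc)

theorem superLambda_of_forall [Finite V] [Nontrivial V]
    (h : ∀ F : Finset (V × V), F.card ≤ minDeg G → ¬ StronglyConnected (deleteArcs G F) →
      IsTrivialArcSet G F) : SuperLambda G :=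
  fun F hF hcard => h F (hcard ▸ arcConnectivity_le_minDeg G) hF.2

theorem superKappa_of_forall [Finite V] [Nonempty V] (hG : ∀ v, ¬ G.Adj v v)
    (h : ∀ S : Finset V, S.card ≤ minDeg G → IsVertexDisconnecting G S →
      IsTrivialVertexSet G S) : SuperKappa G :=
  fun S hS hcard => h S (hcard ▸ vertexConnectivity_le_minDeg hG) hS

theorem maximallyVertexConnected_of_forall [Finite V] [Nonempty V] (hG : ∀ v, ¬ G.Adj v v)
    (h : ∀ S : Finset V, S.card < minDeg G → ¬ IsVertexDisconnecting G S) :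
    MaximallyVertexConnected G := by
  refine le_antisymm (vertexConnectivity_le_minDeg hG) (le_csInf ?_ ?_)
  · have := Fintype.ofFinite V
    refine ⟨_, Finset.univ, Or.inr ⟨fun a => absurd (Finset.mem_univ a.1) a.2⟩, rfl⟩
  · rintro _ ⟨S, hS, rfl⟩
    by_contra! hlt
    exact h S hlt hS

theorem minDeg_le_outDeg (G : Digraph V) (v : V) : minDeg G ≤ outDeg G v :=
  Nat.sInf_le ⟨v, Or.inl rfl⟩

theorem minDeg_le_inDeg (G : Digraph V) (v : V) : minDeg G ≤ inDeg G v :=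
  Nat.sInf_le ⟨v, Or.inr rfl⟩

theorem exists_set_of_not_stronglyConnected {F : Finset (V × V)}
    (h : ¬ StronglyConnected (deleteArcs G F)) :
    ∃ X : Set V, (∀ u ∈ X, ∀ v ∉ X, G.Adj u v → (u, v) ∈ F) ∧ X.Nonempty ∧ Xᶜ.Nonempty := by
  simp only [StronglyConnected] at h
  push Not at h
  obtain ⟨a, b, hab⟩ := h
  refine ⟨{u | Relation.ReflTransGen (deleteArcs G F).Adj a u}, fun u hu v hv huv => ?_,
    ⟨a, Relation.ReflTransGen.refl⟩, ⟨b, hab⟩⟩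
  by_contra hF
  exact hv (hu.tail ⟨huv, hF⟩)

/-- All arcs at the single vertex of the small side, at least δ in number, are in `F`, which has at
most δ elements. -/
theorem isTrivialArcSet_of_subsingleton [Finite V] (hG : ∀ v, ¬ G.Adj v v) {X : Set V}
    {F : Finset (V × V)} (hF : F.card ≤ minDeg G)
    (hX : ∀ u ∈ X, ∀ v ∉ X, G.Adj u v → (u, v) ∈ F) (hne : X.Nonempty)
    (hne' : Xᶜ.Nonempty) (h : X.Subsingleton ∨ Xᶜ.Subsingleton) : IsTrivialArcSet G F := by
  rcases h with h | h
  · obtain ⟨x, hx⟩ := hne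
    have hsub : outArcs G x ⊆ (F : Set (V × V)) := by
      rintro ⟨u, v⟩ ⟨huv, rfl⟩
      exact hX _ hx v (fun hv => hG v (h hx hv ▸ huv)) huv
    have h1 := Set.ncard_le_ncard hsub
    rw [ncard_outArcs, Set.ncard_coe_finset] at h1
    have h2 := minDeg_le_outDeg G x
    refine ⟨x, Or.inl ⟨by omega, (Set.eq_of_subset_of_ncard_le hsub ?_).symm⟩⟩
    rw [ncard_outArcs, Set.ncard_coe_finset]
    omega
  · obtain ⟨x, hx⟩ := hne'
    have hsub : inArcs G x ⊆ (F : Set (V × V)) := by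
      rintro ⟨u, v⟩ ⟨huv, rfl⟩
      refine hX u ?_ _ hx huv
      by_contra hu
      have huv' : v = u := h hx hu
      exact hG u (huv' ▸ huv)
    have h1 := Set.ncard_le_ncard hsub
    rw [ncard_inArcs, Set.ncard_coe_finset] at h1
    have h2 := minDeg_le_inDeg G x
    refine ⟨x, Or.inr ⟨by omega, (Set.eq_of_subset_of_ncard_le hsub ?_).symm⟩⟩
    rw [ncard_inArcs, Set.ncard_coe_finset]
    omega

theorem exists_set_of_not_stronglyConnected_deleteVerts {S : Finset V}
    (h : ¬ StronglyConnected (deleteVerts G S)) :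
    ∃ X : Set V, (∀ u ∈ X, ∀ v ∉ X, G.Adj u v → v ∈ S) ∧ (∃ u ∈ X, u ∉ S) ∧
      (∃ v ∉ X, v ∉ S) ∧ ∀ u ∈ X, u ∉ S := by
  simp only [StronglyConnected] at h
  push Not at h
  obtain ⟨a, b, hab⟩ := h
  refine ⟨{u | ∃ hu : u ∉ S, Relation.ReflTransGen (deleteVerts G S).Adj a ⟨u, hu⟩},
    fun u ⟨hu, hr⟩ v hv huv => ?_, ⟨a, ⟨a.2, Relation.ReflTransGen.refl⟩, a.2⟩,
    ⟨b, fun ⟨_, hr⟩ => hab hr, b.2⟩, fun u hu => hu.1⟩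
  by_contra hS
  exact hv ⟨hS, hr.tail huv⟩

theorem not_subsingleton_of_card_lt [Finite V] [Nonempty V] (hG : ∀ v, ¬ G.Adj v v)
    {S : Finset V} (hS : S.card < minDeg G) : ¬ Subsingleton {v : V // v ∉ S} := by
  have h : ∀ v, ∃ w, G.Adj v w ∧ w ∉ S := by
    intro v
    by_contra! hv
    have h1 := Set.ncard_le_ncard (s := outNbrs G v) (t := (S : Set V)) fun w hw => hv w hw
    rw [Set.ncard_coe_finset] at h1
    exact absurd (minDeg_le_outDeg G v) (by rw [outDeg]; omega)
  intro hs
  obtain ⟨v, -, hv⟩ := h (Classical.arbitrary V)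
  obtain ⟨w, hvw, hw⟩ := h v
  have := congrArg Subtype.val (hs.elim ⟨v, hv⟩ ⟨w, hw⟩)
  simp only at this
  exact hG v (by rwa [← this] at hvw)

end General

/-! ### Degrees of the subKautz digraph -/

theorem outDeg_subKautz (hℓ : 2 ≤ ℓ) (u : KautzWord d ℓ) :
    outDeg (subKautz d ℓ) u = u.free.card := by
  have h : (fun v : KautzWord d ℓ => v.letter (ℓ - 1)) '' outNbrs (subKautz d ℓ) u = u.free := by
    ext a
    simp only [Set.mem_image, Finset.mem_coe, KautzWord.mem_free]
    constructor
    · rintro ⟨v, hv, rfl⟩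
      exact ((subKautz_adj_iff hℓ).1 hv).2
    · rintro ⟨h0, h1⟩
      exact subKautz_exists_adj hℓ u h0 h1
  rw [← Set.ncard_coe_finset, ← h, Set.InjOn.ncard_image, outDeg]
  exact fun v hv w hw hvw => subKautz_adj_unique hℓ hv hw hvw

theorem inDeg_subKautz (hℓ : 2 ≤ ℓ) (u : KautzWord d ℓ) :
    inDeg (subKautz d ℓ) u = u.free.card := by
  have hfree : u.rev.free = u.free := by
    ext a
    rw [KautzWord.mem_free, KautzWord.mem_free, u.letter_rev (by omega), u.letter_rev (by omega),
      Nat.sub_self, Nat.sub_zero, and_comm]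
  have h : KautzWord.rev '' inNbrs (subKautz d ℓ) u = outNbrs (subKautz d ℓ) u.rev := by
    ext v
    constructor
    · rintro ⟨w, hw, rfl⟩
      exact subKautz_adj_rev hℓ hw
    · intro hv
      refine ⟨v.rev, ?_, v.rev_rev⟩
      have := subKautz_adj_rev hℓ hv
      rwa [u.rev_rev] at this
  rw [← hfree, ← outDeg_subKautz hℓ, outDeg, ← h, Set.ncard_image_of_injective, inDeg]
  exact Function.LeftInverse.injective KautzWord.rev_rev

/-- The word `0 t 0 t … (-t)`. -/
theorem exists_alternating (t : ZMod (d + 1)) (ht : t ≠ 0) (ht' : -t ≠ t) (ℓ : ℕ) :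
    ∃ v : KautzWord d (ℓ + 2), v.letter (ℓ + 1) = -t ∧
      ∀ i ≤ ℓ, v.letter i = if Even i then 0 else t := by
  have hg : ∀ i, i + 1 < ℓ + 2 →
      (fun i => if i = ℓ + 1 then -t else if Even i then 0 else t) i ≠
      (fun i => if i = ℓ + 1 then -t else if Even i then 0 else t) (i + 1) := by
    intro i hi
    simp only [show i ≠ ℓ + 1 by omega, if_false, Nat.even_add_one]
    split_ifs
    · exact (neg_ne_zero.2 ht).symm
    · exact ht.symm
    · exact ht'.symm
    · exact ht
  refine ⟨KautzWord.ofFun _ hg, ?_, fun i hi => ?_⟩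
  · rw [KautzWord.letter_ofFun hg (by omega), if_pos rfl]
  · rw [KautzWord.letter_ofFun hg (by omega), if_neg (by omega)]

theorem one_ne_zero_and_neg_one_ne_one (hd : 2 ≤ d) :
    (1 : ZMod (d + 1)) ≠ 0 ∧ (-1 : ZMod (d + 1)) ≠ 1 := by
  have h1 : ¬ (d + 1) ∣ 1 := fun h => by have := Nat.le_of_dvd one_pos h; omega
  have h2 : ¬ (d + 1) ∣ 2 := fun h => by have := Nat.le_of_dvd two_pos h; omega
  rw [← ZMod.natCast_eq_zero_iff] at h1 h2
  refine ⟨by simpa using h1, fun h => h2 ?_⟩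
  have : (1 : ZMod (d + 1)) + 1 = 0 := by
    nth_rewrite 1 [← h]
    exact neg_add_cancel 1
  push_cast
  rw [← this]; norm_num

theorem exists_card_free (hd : 2 ≤ d) (hℓ : 2 ≤ ℓ) :
    ∃ v : KautzWord d ℓ, v.free.card = d - 1 := by
  obtain ⟨n, rfl⟩ : ∃ n, ℓ = n + 2 := ⟨ℓ - 2, by omega⟩
  obtain ⟨h1, h2⟩ := one_ne_zero_and_neg_one_ne_one hd
  obtain ⟨v, hv, hv'⟩ := exists_alternating 1 h1 h2 n
  refine ⟨v, v.card_free_of_ne ?_⟩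
  rw [show n + 2 - 1 = n + 1 by omega, hv, hv' 0 (by omega)]
  simpa using h1

theorem minDeg_subKautz (hd : 2 ≤ d) (hℓ : 2 ≤ ℓ) : minDeg (subKautz d ℓ) = d - 1 := by
  obtain ⟨v, hv⟩ := exists_card_free hd hℓ
  have : Nonempty (KautzWord d ℓ) := ⟨v⟩
  refine minDeg_eq (fun u => ?_) (fun u => ?_) ⟨v, by rw [outDeg_subKautz hℓ, hv]⟩
  · rw [outDeg_subKautz hℓ]
    exact u.card_free
  · rw [inDeg_subKautz hℓ]
    exact u.card_free

/-! ### Arc-cuts of the subKautz digraph -/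

/-- A digon makes the letters of `u` alternate with period two, and the arc back to `u` forbids
ending in the second letter. -/
theorem letter_zero_eq_last_of_digon (hℓ : 2 ≤ ℓ) {u v : KautzWord d ℓ}
    (huv : (subKautz d ℓ).Adj u v) (hvu : (subKautz d ℓ).Adj v u) :
    u.letter 0 = u.letter (ℓ - 1) := by
  have h : ∀ i < ℓ, u.letter i = u.letter 0 ∨ u.letter i = u.letter 1 := by
    intro i
    induction i using Nat.twoStepInduction with
    | zero => exact fun _ => Or.inl rfl
    | one => exact fun _ => Or.inr rfl
    | more i ih _ =>
      intro hi
      rw [← subKautz_adj_letter hℓ huv hi, ← subKautz_adj_letter hℓ hvu (by omega)]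
      exact ih (by omega)
  rcases h (ℓ - 1) (by omega) with h | h
  · exact h.symm
  · rw [← subKautz_adj_letter hℓ huv (by omega)] at h
    exact absurd h ((subKautz_adj_iff hℓ).1 hvu).2.1

/-- Each out-neighbour `w` of `v ∈ X` gives an arc of `F`: a chosen exit of `w` if `w ∈ X`, else
`(v, w)`. This injection is onto, so `v` has out-degree `d - 1` and is adjacent to all other words
of `X`. Two words of `X` would form a digon, whose words have out-degree `d`. -/
theorem eq_of_forall_exit (hℓ : 2 ≤ ℓ) {X : Set (KautzWord d ℓ)}
    {F : Finset (KautzWord d ℓ × KautzWord d ℓ)} (hF : F.card ≤ d - 1)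
    (hX : ∀ u ∈ X, ∀ v ∉ X, (subKautz d ℓ).Adj u v → (u, v) ∈ F)
    (hexit : ∀ u ∈ X, ∃ v, (u, v) ∈ F) {x y : KautzWord d ℓ}
    (hx : x ∈ X) (hy : y ∈ X) : x = y := by
  classical
  by_contra hxy
  have : Nonempty (KautzWord d ℓ) := ⟨x⟩
  choose! e he using hexit
  have key : ∀ v ∈ X, v.free.card ≤ d - 1 ∧ ∀ u ∈ X, v ≠ u → (subKautz d ℓ).Adj v u := by
    intro v hv
    have hfin := (outNbrs (subKautz d ℓ) v).toFinite
    have hmem : ∀ w, w ∈ hfin.toFinset ↔ (subKautz d ℓ).Adj v w := fun w => hfin.mem_toFinset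
    have hcard : hfin.toFinset.card = v.free.card := by
      rw [← Set.ncard_eq_toFinset_card _ hfin, ← outDeg_subKautz hℓ, outDeg]
    set φ : KautzWord d ℓ → KautzWord d ℓ × KautzWord d ℓ :=
      fun w => if w ∈ X then (w, e w) else (v, w) with hφ
    have hmaps : Set.MapsTo φ hfin.toFinset F := by
      intro w hw
      rw [Finset.mem_coe, hmem] at hw
      by_cases hwX : w ∈ X
      · simpa only [hφ, if_pos hwX] using Finset.mem_coe.2 (he w hwX)
      · simpa only [hφ, if_neg hwX] using Finset.mem_coe.2 (hX v hv w hwX hw)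
    have hinj : Set.InjOn φ hfin.toFinset := by
      intro w hw w' hw' h
      rw [Finset.mem_coe, hmem] at hw hw'
      by_cases hwX : w ∈ X <;> by_cases hwX' : w' ∈ X <;>
        simp only [hφ, hwX, hwX', if_true, if_false, Prod.mk.injEq] at h
      · exact h.1
      · exact absurd (h.1 ▸ hw) (subKautz_irrefl hℓ v)
      · exact absurd (h.1 ▸ hw') (subKautz_irrefl hℓ _)
      · exact h.2
    have h1 := Finset.card_le_card_of_injOn φ hmaps hinj
    have h2 := v.card_free
    refine ⟨by omega, fun u hu hvu => ?_⟩
    obtain ⟨w, hw, hwu⟩ := Finset.surjOn_of_injOn_of_card_le φ hmaps hinj (by omega) (he u hu)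
    rw [Finset.mem_coe, hmem] at hw
    by_cases hwX : w ∈ X <;> simp only [hφ, hwX, if_true, if_false, Prod.mk.injEq] at hwu
    · rwa [← hwu.1]
    · exact absurd hwu.1 hvu
  have h1 := letter_zero_eq_last_of_digon hℓ ((key x hx).2 y hy hxy)
    ((key y hy).2 x hx (Ne.symm hxy))
  have h2 := x.card_free_of_eq h1
  have h3 := (key x hx).1
  have h4 : 0 < d := by
    by_contra h4
    have : F = ∅ := Finset.card_eq_zero.1 (by omega)
    have := he x hx
    simp_all
  omega

theorem eq_of_forall_entry (hℓ : 2 ≤ ℓ) {Y : Set (KautzWord d ℓ)}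
    {F : Finset (KautzWord d ℓ × KautzWord d ℓ)} (hF : F.card ≤ d - 1)
    (hY : ∀ u ∉ Y, ∀ v ∈ Y, (subKautz d ℓ).Adj u v → (u, v) ∈ F)
    (hentry : ∀ v ∈ Y, ∃ u, (u, v) ∈ F) {x y : KautzWord d ℓ}
    (hx : x ∈ Y) (hy : y ∈ Y) : x = y := by
  classical
  have hmem : ∀ u v : KautzWord d ℓ, (u, v) ∈ F →
      (v.rev, u.rev) ∈ F.image fun e => (e.2.rev, e.1.rev) :=
    fun u v h => Finset.mem_image_of_mem (fun e => (e.2.rev, e.1.rev)) h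
  rw [← x.rev_rev] at hx
  rw [← y.rev_rev] at hy
  have := eq_of_forall_exit hℓ (X := {v | v.rev ∈ Y}) (F := F.image fun e => (e.2.rev, e.1.rev))
    (Finset.card_image_le.trans hF)
    (fun u hu v hv huv => by
      have := hmem _ _ (hY _ hv _ hu (subKautz_adj_rev hℓ huv))
      rwa [u.rev_rev, v.rev_rev] at this)
    (fun v hv => by
      obtain ⟨u, hu⟩ := hentry _ hv
      have := hmem _ _ hu
      rw [v.rev_rev] at this
      exact ⟨_, this⟩) hx hy
  rw [← x.rev_rev, this, y.rev_rev]

/-- A nontrivial set of words with nontrivial complement is left by at least `d` arcs. -/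
theorem subsingleton_or_of_card_exits_le (hd : 3 ≤ d) (hℓ : 2 ≤ ℓ) {X : Set (KautzWord d ℓ)}
    {F : Finset (KautzWord d ℓ × KautzWord d ℓ)} (hF : F.card ≤ d - 1)
    (hX : ∀ u ∈ X, ∀ v ∉ X, (subKautz d ℓ).Adj u v → (u, v) ∈ F) :
    X.Subsingleton ∨ Xᶜ.Subsingleton := by
  classical
  wlog hF' : ∀ e ∈ F, e.1 ∈ X ∧ e.2 ∉ X generalizing F
  · refine this (F := F.filter fun e => e.1 ∈ X ∧ e.2 ∉ X)
      ((Finset.card_filter_le _ _).trans hF) (fun u hu v hv huv => ?_) fun e he => ?_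
    · exact Finset.mem_filter.2 ⟨hX u hu v hv huv, hu, hv⟩
    · exact (Finset.mem_filter.1 he).2
  have hfst : ∀ u, u ∈ F.image Prod.fst ↔ ∃ v, (u, v) ∈ F := by simp
  have hsnd : ∀ v, v ∈ F.image Prod.snd ↔ ∃ u, (u, v) ∈ F := by simp
  by_cases h1 : ∃ u ∈ X, u ∉ F.image Prod.fst
  swap
  · push Not at h1
    exact Or.inl fun x hx y hy => eq_of_forall_exit hℓ hF hX
      (fun u hu => (hfst u).1 (h1 u hu)) hx hy
  by_cases h2 : ∃ v ∈ Xᶜ, v ∉ F.image Prod.snd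
  swap
  · push Not at h2
    exact Or.inr fun x hx y hy => eq_of_forall_entry hℓ hF
      (fun u hu v hv => hX u (not_not.1 hu) v hv) (fun u hu => (hsnd u).1 (h2 u hu)) hx hy
  exfalso
  obtain ⟨x, hx, hxd⟩ := exists_deepTo hd (Finset.card_image_le.trans hF)
    (fun u hu huT v huv => by
      by_contra hv
      exact huT ((hfst u).2 ⟨v, hX u hu v hv huv⟩))
    -- With `d - 1` distinct tails, no two arcs of `F` share a tail.
    (fun hcard u hu v w huv huw hv hw => by
      have hinj : Set.InjOn Prod.fst (F : Set (KautzWord d ℓ × KautzWord d ℓ)) :=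
        Finset.card_image_iff.1 (le_antisymm Finset.card_image_le (by omega))
      obtain ⟨t, ht⟩ := (hfst u).1 hu
      have huX := (hF' _ ht).1
      exact congrArg Prod.snd (hinj (hX u huX v hv huv) (hX u huX w hw huw) rfl)) h1
  obtain ⟨y, hy, hyd⟩ := exists_coDeepTo hd hℓ (Finset.card_image_le.trans hF)
    (fun u hu huT v huv => by
      intro hv
      exact huT ((hsnd u).2 ⟨v, hX v hv u hu huv⟩))
    (fun hcard u hu v w huv huw hv hw => by
      have hinj : Set.InjOn Prod.snd (F : Set (KautzWord d ℓ × KautzWord d ℓ)) :=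
        Finset.card_image_iff.1 (le_antisymm Finset.card_image_le (by omega))
      obtain ⟨t, ht⟩ := (hsnd u).1 hu
      have huX := (hF' _ ht).2
      exact congrArg Prod.fst (hinj (hX v (not_not.1 hv) u huX huv)
        (hX w (not_not.1 hw) u huX huw) rfl)) h2
  exact false_of_deepTo_arcs hd hℓ hF hX hx hxd hy hyd

theorem nontrivial_kautzWord (hd : 2 ≤ d) (hℓ : 2 ≤ ℓ) : Nontrivial (KautzWord d ℓ) := by
  obtain ⟨v, hv⟩ := exists_card_free hd hℓ
  have : v.free.Nonempty := Finset.card_pos.1 (by omega)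
  obtain ⟨a, ha⟩ := this
  rw [KautzWord.mem_free] at ha
  obtain ⟨w, hw, -⟩ := subKautz_exists_adj hℓ v ha.1 ha.2
  exact ⟨v, w, fun h => subKautz_irrefl hℓ v (by rwa [← h] at hw)⟩

theorem superLambda_subKautz (hd : 3 ≤ d) (hℓ : 2 ≤ ℓ) : SuperLambda (subKautz d ℓ) := by
  have hmin := minDeg_subKautz (d := d) (by omega) hℓ
  have := nontrivial_kautzWord (d := d) (by omega) hℓ
  refine superLambda_of_forall fun F hF hsc => ?_
  obtain ⟨X, hX, hne, hne'⟩ := exists_set_of_not_stronglyConnected hsc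
  exact isTrivialArcSet_of_subsingleton (subKautz_irrefl hℓ) hF hX hne hne'
    (subsingleton_or_of_card_exits_le hd hℓ (hmin ▸ hF) hX)

theorem maximallyVertexConnected_subKautz (hd : 3 ≤ d) (hℓ : 2 ≤ ℓ) :
    MaximallyVertexConnected (subKautz d ℓ) := by
  have hmin := minDeg_subKautz (d := d) (by omega) hℓ
  have := nontrivial_kautzWord (d := d) (by omega) hℓ
  refine maximallyVertexConnected_of_forall (subKautz_irrefl hℓ) fun S hS hdis => ?_
  rcases hdis with hsc | hs
  swap
  · exact not_subsingleton_of_card_lt (subKautz_irrefl hℓ) hS hs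
  rw [hmin] at hS
  obtain ⟨X, hX, ⟨a, haX, haS⟩, ⟨b, hbX, hbS⟩, -⟩ :=
    exists_set_of_not_stronglyConnected_deleteVerts hsc
  -- The deep words are sought in `X ∪ S`, left only from `S`, and in the complement of `X`, entered
  -- only at `S`; these sets meet inside `S`.
  have hin : ∀ u ∈ X ∪ S, u ∉ S → ∀ v, (subKautz d ℓ).Adj u v → v ∈ X ∪ S := by
    intro u hu huS v huv
    by_contra hv
    rw [Set.mem_union, not_or] at hv
    exact hv.2 (hX u (hu.resolve_right huS) v hv.1 huv)
  have hout : ∀ v ∈ Xᶜ, v ∉ S → ∀ u, (subKautz d ℓ).Adj u v → u ∈ Xᶜ :=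
    fun v hv hvS u huv hu => hvS (hX u hu v hv huv)
  obtain ⟨x, hx, hxd⟩ := exists_deepTo hd (by omega) hin (fun h => by omega)
    ⟨a, Or.inl haX, haS⟩
  obtain ⟨y, hy, hyd⟩ := exists_coDeepTo hd hℓ (by omega) hout (fun h => by omega)
    ⟨b, hbX, hbS⟩
  exact false_of_deepTo_verts hd hℓ (by omega) hin hout
    (fun u hu hu' => hu.resolve_left hu') hx hxd hy hyd

/-! ### The cyclic Kautz digraph as a line digraph -/

variable {m : ℕ}

instance (d ℓ : ℕ) : Finite (CyclicKautzWord d ℓ) :=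
  inferInstanceAs (Finite {x : Fin ℓ → ZMod (d + 1) //
    (∀ i j : Fin ℓ, i.val + 1 = j.val → x i ≠ x j) ∧
      ∀ i j : Fin ℓ, i.val = 0 → j.val + 1 = ℓ → x j ≠ x i})

/-- The word without its last letter. -/
def CyclicKautzWord.pre (z : CyclicKautzWord d (m + 1)) : KautzWord d m :=
  ⟨fun i => z.1 i.castSucc, fun i j h => z.2.1 _ _ (by simpa using h)⟩

/-- The word without its first letter. -/
def CyclicKautzWord.suf (z : CyclicKautzWord d (m + 1)) : KautzWord d m :=
  ⟨fun i => z.1 i.succ, fun i j h => z.2.1 _ _ (by simpa using h)⟩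

/-- The arc of the subKautz digraph corresponding to a vertex of the cyclic Kautz digraph. -/
def CyclicKautzWord.arc (z : CyclicKautzWord d (m + 1)) : KautzWord d m × KautzWord d m :=
  (z.pre, z.suf)

theorem CyclicKautzWord.ext_pre_suf (hm : 1 ≤ m) {z z' : CyclicKautzWord d (m + 1)}
    (h : z.pre = z'.pre) (h' : z.suf = z'.suf) : z = z' := by
  apply Subtype.ext
  funext i
  cases i using Fin.cases with
  | zero =>
    have := congrFun (congrArg Subtype.val h) ⟨0, hm⟩
    exact this
  | succ i => exact congrFun (congrArg Subtype.val h') i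

theorem CyclicKautzWord.arc_injective (hm : 1 ≤ m) :
    Function.Injective (CyclicKautzWord.arc : CyclicKautzWord d (m + 1) → _) := fun _ _ h =>
  CyclicKautzWord.ext_pre_suf hm (congrArg Prod.fst h) (congrArg Prod.snd h)

theorem CyclicKautzWord.adj_pre_suf (z : CyclicKautzWord d (m + 1)) :
    (subKautz d m).Adj z.pre z.suf := by
  refine ⟨fun i j h => congrArg z.1 (Fin.ext (by simpa using h)), fun i j hi hj => ⟨?_, ?_⟩⟩
  · exact z.2.2 i.castSucc j.succ (by simpa using hi) (by simpa using hj)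
  · exact (z.2.1 j.castSucc j.succ (by simp)).symm

theorem exists_arc_eq (hm : 1 ≤ m) {u v : KautzWord d m} (h : (subKautz d m).Adj u v) :
    ∃ z : CyclicKautzWord d (m + 1), z.pre = u ∧ z.suf = v := by
  have hcs : ∀ i : Fin m, (Fin.cons (u.1 ⟨0, hm⟩) v.1 : Fin (m + 1) → ZMod (d + 1)) i.castSucc =
      u.1 i := by
    intro i
    rcases i with ⟨_ | i, hi⟩
    · rfl
    · exact h.1 ⟨i, by omega⟩ ⟨i + 1, hi⟩ rfl
  refine ⟨⟨Fin.cons (u.1 ⟨0, hm⟩) v.1, fun i j hij => ?_, fun i j hi hj => ?_⟩,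
    Subtype.ext (funext hcs), Subtype.ext (funext fun _ => rfl)⟩
  · obtain ⟨i, rfl⟩ : ∃ i' : Fin m, i = i'.castSucc := ⟨⟨i, by omega⟩, rfl⟩
    obtain rfl : j = i.succ := Fin.ext (by simpa using hij.symm)
    rw [hcs, Fin.cons_succ]
    by_cases hi : i.val + 1 = m
    · exact (h.2 ⟨0, hm⟩ i rfl hi).2.symm
    · have h1 := h.1 i ⟨i + 1, by omega⟩ rfl
      rw [h1]
      exact u.2 _ _ rfl
  · obtain rfl : i = 0 := Fin.ext hi
    obtain ⟨j, rfl⟩ : ∃ j' : Fin m, j = j'.succ :=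
      ⟨⟨j - 1, by omega⟩, Fin.ext (by simp only [Fin.succ_mk]; omega)⟩
    rw [Fin.cons_zero, Fin.cons_succ]
    exact (h.2 ⟨0, hm⟩ j rfl (by simpa using hj)).1

/-- The two conditions on the new letter only say that the new word is again cyclic Kautz. What is
left is the overlap, which is adjacency in the line digraph. -/
theorem cyclicKautz_adj_iff (hm : 1 ≤ m) {z z' : CyclicKautzWord d (m + 1)} :
    (cyclicKautz d (m + 1)).Adj z z' ↔ z.suf = z'.pre := by
  constructor
  · intro h
    refine Subtype.ext (funext fun i => ?_)
    exact (h.1 i.castSucc i.succ (by simp)).symm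
  · intro h
    have h' : ∀ i : Fin m, z.1 i.succ = z'.1 i.castSucc :=
      fun i => congrFun (congrArg Subtype.val h) i
    refine ⟨fun i j hij => ?_, fun i j hi hj => ⟨?_, ?_⟩⟩
    · obtain ⟨i, rfl⟩ : ∃ i' : Fin m, i = i'.castSucc := ⟨⟨i, by omega⟩, rfl⟩
      obtain rfl : j = i.succ := Fin.ext (by simpa using hij.symm)
      exact (h' i).symm
    · obtain rfl : i = (⟨0, hm⟩ : Fin m).succ := Fin.ext hi
      rw [h']
      exact z'.2.2 _ _ rfl hj
    · obtain ⟨j, rfl⟩ : ∃ j' : Fin m, j = j'.succ :=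
        ⟨⟨j - 1, by omega⟩, Fin.ext (by simp only [Fin.succ_mk]; omega)⟩
      rw [h']
      exact (z'.2.1 _ _ (by simp)).symm

theorem cyclicKautz_irrefl (hm : 1 ≤ m) (z : CyclicKautzWord d (m + 1)) :
    ¬ (cyclicKautz d (m + 1)).Adj z z := fun h =>
  z.2.1 0 ⟨1, by omega⟩ rfl
    (congrFun (congrArg Subtype.val ((cyclicKautz_adj_iff hm).1 h)) ⟨0, hm⟩).symm

theorem image_arc_pre (hm : 1 ≤ m) (p : KautzWord d m) :
    CyclicKautzWord.arc '' {z | z.pre = p} = outArcs (subKautz d m) p := by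
  ext ⟨u, v⟩
  constructor
  · rintro ⟨z, rfl, h⟩
    rw [← h]
    exact ⟨z.adj_pre_suf, rfl⟩
  · rintro ⟨h, rfl⟩
    obtain ⟨z, rfl, rfl⟩ := exists_arc_eq hm h
    exact ⟨z, rfl, rfl⟩

theorem image_arc_suf (hm : 1 ≤ m) (p : KautzWord d m) :
    CyclicKautzWord.arc '' {z | z.suf = p} = inArcs (subKautz d m) p := by
  ext ⟨u, v⟩
  constructor
  · rintro ⟨z, rfl, h⟩
    rw [← h]
    exact ⟨z.adj_pre_suf, rfl⟩
  · rintro ⟨h, rfl⟩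
    obtain ⟨z, rfl, rfl⟩ := exists_arc_eq hm h
    exact ⟨z, rfl, rfl⟩

theorem outNbrs_cyclicKautz (hm : 1 ≤ m) (z : CyclicKautzWord d (m + 1)) :
    outNbrs (cyclicKautz d (m + 1)) z = {z' | z'.pre = z.suf} := by
  ext z'
  exact (cyclicKautz_adj_iff hm).trans eq_comm

theorem inNbrs_cyclicKautz (hm : 1 ≤ m) (z : CyclicKautzWord d (m + 1)) :
    inNbrs (cyclicKautz d (m + 1)) z = {z' | z'.suf = z.pre} := by
  ext z'
  exact cyclicKautz_adj_iff hm

theorem outDeg_cyclicKautz (hm : 1 ≤ m) (z : CyclicKautzWord d (m + 1)) :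
    outDeg (cyclicKautz d (m + 1)) z = outDeg (subKautz d m) z.suf := by
  rw [← ncard_outArcs (subKautz d m), ← image_arc_pre hm,
    Set.ncard_image_of_injective _ (CyclicKautzWord.arc_injective hm), outDeg,
    outNbrs_cyclicKautz hm]

theorem inDeg_cyclicKautz (hm : 1 ≤ m) (z : CyclicKautzWord d (m + 1)) :
    inDeg (cyclicKautz d (m + 1)) z = inDeg (subKautz d m) z.pre := by
  rw [← ncard_inArcs (subKautz d m), ← image_arc_suf hm,
    Set.ncard_image_of_injective _ (CyclicKautzWord.arc_injective hm), inDeg,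
    inNbrs_cyclicKautz hm]

theorem exists_suf_eq (hd : 2 ≤ d) (hm : 2 ≤ m) (p : KautzWord d m) :
    ∃ z : CyclicKautzWord d (m + 1), z.suf = p := by
  have h : 0 < inDeg (subKautz d m) p := by
    rw [inDeg_subKautz hm]
    have := p.card_free
    omega
  obtain ⟨u, hu⟩ := Set.nonempty_of_ncard_ne_zero h.ne'
  obtain ⟨z, -, hz⟩ := exists_arc_eq (by omega) hu
  exact ⟨z, hz⟩

theorem exists_pre_eq (hd : 2 ≤ d) (hm : 2 ≤ m) (p : KautzWord d m) :
    ∃ z : CyclicKautzWord d (m + 1), z.pre = p := by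
  have h : 0 < outDeg (subKautz d m) p := by
    rw [outDeg_subKautz hm]
    have := p.card_free
    omega
  obtain ⟨u, hu⟩ := Set.nonempty_of_ncard_ne_zero h.ne'
  obtain ⟨z, hz, -⟩ := exists_arc_eq (by omega) hu
  exact ⟨z, hz⟩

theorem minDeg_cyclicKautz (hd : 2 ≤ d) (hm : 2 ≤ m) :
    minDeg (cyclicKautz d (m + 1)) = d - 1 := by
  obtain ⟨p, hp⟩ := exists_card_free hd hm
  obtain ⟨z, rfl⟩ := exists_suf_eq hd hm p
  have : Nonempty (CyclicKautzWord d (m + 1)) := ⟨z⟩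
  refine minDeg_eq (fun u => ?_) (fun u => ?_) ⟨z, ?_⟩
  · rw [outDeg_cyclicKautz (by omega), outDeg_subKautz hm]
    exact u.suf.card_free
  · rw [inDeg_cyclicKautz (by omega), inDeg_subKautz hm]
    exact u.pre.card_free
  · rw [outDeg_cyclicKautz (by omega), outDeg_subKautz hm, hp]

/-- Translates of a word from `0` to `1` and of one from `0` to `-1` are told apart by their first
and last letters. The bound excludes small cuts that leave at most one vertex or touch every vertex.
-/
theorem two_mul_le_card_cyclicKautzWord (hd : 2 ≤ d) (hm : 1 ≤ m) :
    2 * d ≤ Nat.card (CyclicKautzWord d (m + 1)) := by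
  obtain ⟨n, rfl⟩ : ∃ n, m = n + 1 := ⟨m - 1, by omega⟩
  obtain ⟨h1, h2⟩ := one_ne_zero_and_neg_one_ne_one hd
  obtain ⟨v, hv, hv0⟩ := exists_alternating 1 h1 h2 n
  obtain ⟨w, hw, hw0⟩ := exists_alternating (-1) (neg_ne_zero.2 h1) (by rwa [neg_neg, ne_comm]) n
  have hx : ∀ b : Bool, ∃ x : KautzWord d (n + 2), x.letter 0 = 0 ∧
      x.letter (n + 1) = if b then -1 else 1 := by
    rintro (_ | _)
    · exact ⟨w, by simpa using hw0 0 (by omega), by simpa using hw⟩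
    · exact ⟨v, by simpa using hv0 0 (by omega), by simpa using hv⟩
  choose x hx0 hx1 using hx
  have hlast : ∀ b, (x b).letter (n + 1) ≠ 0 := by
    rintro (_ | _) <;> rw [hx1]
    · simpa using h1
    · simpa using h1
  let φ : ZMod (d + 1) × Bool → CyclicKautzWord d (n + 1 + 1) := fun c =>
    ⟨fun i => c.1 + (x c.2).1 i, fun i j hij h => (x c.2).2 i j hij (add_left_cancel h),
      fun i j hi hj h => by
        have h := add_left_cancel h
        rw [KautzWord.letter_eq, KautzWord.letter_eq, hi, show j.val = n + 1 by omega, hx0] at h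
        exact hlast _ h⟩
  have hφ : Function.Injective φ := by
    rintro ⟨a, b⟩ ⟨a', b'⟩ h
    have h := congrArg Subtype.val h
    have e0 := congrFun h ⟨0, by omega⟩
    have e1 := congrFun h ⟨n + 1, by omega⟩
    simp only [φ, KautzWord.letter_eq, hx0, hx1, add_zero] at e0 e1
    subst e0
    have e1 := add_left_cancel e1
    rw [Prod.mk.injEq, and_iff_right rfl]
    cases b <;> cases b'
    · rfl
    · exact absurd e1.symm (by simpa using h2)
    · exact absurd e1 (by simpa using h2)
    · rfl
  have := Nat.card_le_card_of_injective φ hφ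
  rw [Nat.card_prod, Nat.card_zmod, Nat.card_eq_fintype_card, Fintype.card_bool] at this
  omega

/-- A vertex-cut of the cyclic Kautz digraph is an arc-cut of the subKautz digraph. -/
theorem exists_arc_cut_of_vertex_cut [DecidableEq (KautzWord d m)] (hm : 1 ≤ m)
    {X : Set (CyclicKautzWord d (m + 1))} {S : Finset (CyclicKautzWord d (m + 1))}
    (hX : ∀ u ∈ X, u ∉ S → ∀ v ∉ X, (cyclicKautz d (m + 1)).Adj u v → v ∈ S)
    (hne : ∃ u ∈ X, u ∉ S) (hne' : ∃ v ∉ X, v ∉ S) :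
    ∃ P : Set (KautzWord d m), (∀ u ∈ P, ∀ v ∉ P, (subKautz d m).Adj u v →
      (u, v) ∈ S.image CyclicKautzWord.arc) ∧ P.Nonempty ∧ Pᶜ.Nonempty := by
  obtain ⟨a, haX, haS⟩ := hne
  obtain ⟨b, hbX, hbS⟩ := hne'
  -- `P` collects the suffixes of the surviving words of `X`; an arc leaving `P` is a word that
  -- follows one of them and must have been deleted.
  refine ⟨{p | ∃ z ∈ X, z ∉ S ∧ z.suf = p}, ?_, ⟨a.suf, a, haX, haS, rfl⟩, b.pre, ?_⟩
  · rintro _ ⟨z, hzX, hzS, rfl⟩ q hq hadj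
    obtain ⟨e, he, rfl⟩ := exists_arc_eq hm hadj
    refine Finset.mem_image.2 ⟨e, ?_, by rw [CyclicKautzWord.arc, he]⟩
    by_contra heS
    refine hq ⟨e, ?_, heS, rfl⟩
    by_contra heX
    exact heS (hX z hzX hzS e heX ((cyclicKautz_adj_iff hm).2 he.symm))
  · rintro ⟨z, hzX, hzS, hz⟩
    exact hbS (hX z hzX hzS b hbX ((cyclicKautz_adj_iff hm).2 hz))

/-- A vertex-cut with at most `d - 1` words consists of all words with a given prefix, or of all
words with a given suffix. -/
theorem vertex_cut_cyclicKautz (hd : 3 ≤ d) (hm : 2 ≤ m) {X : Set (CyclicKautzWord d (m + 1))}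
    {S : Finset (CyclicKautzWord d (m + 1))} (hS : S.card ≤ d - 1)
    (hX : ∀ u ∈ X, u ∉ S → ∀ v ∉ X, (cyclicKautz d (m + 1)).Adj u v → v ∈ S)
    (hne : ∃ u ∈ X, u ∉ S) (hne' : ∃ v ∉ X, v ∉ S) :
    S.card = d - 1 ∧ ∃ p : KautzWord d m, p.free.card = d - 1 ∧
      ((S : Set (CyclicKautzWord d (m + 1))) = {z | z.pre = p} ∨
        (S : Set (CyclicKautzWord d (m + 1))) = {z | z.suf = p}) := by
  classical
  have hm1 : 1 ≤ m := by omega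
  have hinj := CyclicKautzWord.arc_injective (d := d) hm1
  obtain ⟨P, hP, hPne, hPne'⟩ := exists_arc_cut_of_vertex_cut hm1 hX hne hne'
  have hmin := minDeg_subKautz (d := d) (by omega) hm
  have hcard : (S.image CyclicKautzWord.arc).card ≤ d - 1 := Finset.card_image_le.trans hS
  obtain ⟨p, hp⟩ := isTrivialArcSet_of_subsingleton (subKautz_irrefl hm) (hmin ▸ hcard) hP hPne
    hPne' (subsingleton_or_of_card_exits_le hd hm hcard hP)
  rw [hmin, outDeg_subKautz hm, inDeg_subKautz hm, Finset.coe_image, ← image_arc_pre hm1,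
    ← image_arc_suf hm1, Set.image_eq_image hinj, Set.image_eq_image hinj, ← and_or_left] at hp
  refine ⟨?_, p, hp⟩
  rw [← Set.ncard_coe_finset, ← Set.ncard_image_of_injective _ hinj]
  rcases hp with ⟨hp, h | h⟩
  · rw [h, image_arc_pre hm1, ncard_outArcs, outDeg_subKautz hm, hp]
  · rw [h, image_arc_suf hm1, ncard_inArcs, inDeg_subKautz hm, hp]

theorem nontrivial_cyclicKautzWord (hd : 2 ≤ d) (hm : 1 ≤ m) :
    Nontrivial (CyclicKautzWord d (m + 1)) := by
  rw [← Finite.one_lt_card_iff_nontrivial]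
  have := two_mul_le_card_cyclicKautzWord hd hm
  omega

theorem superKappa_cyclicKautz (hd : 3 ≤ d) (hm : 2 ≤ m) :
    SuperKappa (cyclicKautz d (m + 1)) := by
  have hm1 : 1 ≤ m := by omega
  have hmin := minDeg_cyclicKautz (d := d) (by omega) hm
  have := nontrivial_cyclicKautzWord (d := d) (by omega) hm1
  refine superKappa_of_forall (cyclicKautz_irrefl hm1) fun S hS hdis => ?_
  rw [hmin] at hS
  rcases hdis with hsc | hs
  · obtain ⟨X, hX, hne, hne', -⟩ := exists_set_of_not_stronglyConnected_deleteVerts hsc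
    obtain ⟨-, p, hp, h | h⟩ := vertex_cut_cyclicKautz hd hm hS (fun u hu _ => hX u hu) hne hne'
    · obtain ⟨z, rfl⟩ := exists_suf_eq (by omega) hm p
      refine ⟨z, Or.inl ⟨?_, by rw [h, outNbrs_cyclicKautz hm1]⟩⟩
      rw [outDeg_cyclicKautz hm1, outDeg_subKautz hm, hp, hmin]
    · obtain ⟨z, rfl⟩ := exists_pre_eq (by omega) hm p
      refine ⟨z, Or.inr ⟨?_, by rw [h, inNbrs_cyclicKautz hm1]⟩⟩
      rw [inDeg_cyclicKautz hm1, inDeg_subKautz hm, hp, hmin]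
  · exfalso
    have h1 := two_mul_le_card_cyclicKautzWord (d := d) (by omega) hm1
    have h2 := Finite.card_le_one_iff_subsingleton.2 hs
    have h3 := Set.ncard_add_ncard_compl (S : Set (CyclicKautzWord d (m + 1)))
    have h4 : (S : Set (CyclicKautzWord d (m + 1)))ᶜ.ncard =
        Nat.card {v : CyclicKautzWord d (m + 1) // v ∉ S} := rfl
    rw [Set.ncard_coe_finset] at h3
    omega

theorem maximallyVertexConnected_cyclicKautz (hd : 3 ≤ d) (hm : 2 ≤ m) :
    MaximallyVertexConnected (cyclicKautz d (m + 1)) := by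
  have hm1 : 1 ≤ m := by omega
  have hmin := minDeg_cyclicKautz (d := d) (by omega) hm
  have := nontrivial_cyclicKautzWord (d := d) (by omega) hm1
  refine maximallyVertexConnected_of_forall (cyclicKautz_irrefl hm1) fun S hS hdis => ?_
  rcases hdis with hsc | hs
  · obtain ⟨X, hX, hne, hne', -⟩ := exists_set_of_not_stronglyConnected_deleteVerts hsc
    have := (vertex_cut_cyclicKautz hd hm (by omega) (fun u hu _ => hX u hu) hne hne').1
    omega
  · exact not_subsingleton_of_card_lt (cyclicKautz_irrefl hm1) hS hs

/-! ### Words of length two -/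

theorem subKautz_one_adj_iff {u v : KautzWord d 1} : (subKautz d 1).Adj u v ↔ u ≠ v := by
  constructor
  · rintro h rfl
    exact (h.2 0 0 rfl rfl).1 rfl
  · intro h
    have h0 : v.1 0 ≠ u.1 0 := by
      intro h0
      refine h (Subtype.ext (funext fun i => ?_))
      rw [Subsingleton.elim i 0, h0]
    refine ⟨fun i j hij => by omega, fun i j _ _ => ?_⟩
    rw [Subsingleton.elim i 0, Subsingleton.elim j 0]
    exact ⟨h0, h0⟩

theorem card_kautzWord_one : Nat.card (KautzWord d 1) = d + 1 := by
  have : Function.Bijective fun v : KautzWord d 1 => v.1 0 := by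
    refine ⟨fun u v h => Subtype.ext (funext fun i => ?_), fun a =>
      ⟨⟨fun _ => a, fun i j hij => by omega⟩, rfl⟩⟩
    rw [Subsingleton.elim i 0]
    exact h
  rw [Nat.card_congr (Equiv.ofBijective _ this), Nat.card_zmod]

/-- CK(d,2) is the line digraph of the complete digraph on `d + 1` vertices, in which at least `d`
arcs leave any proper nonempty set. -/
theorem maximallyVertexConnected_cyclicKautz_two (hd : 2 ≤ d) :
    MaximallyVertexConnected (cyclicKautz d 2) := by
  classical
  have hcompl : ∀ u : KautzWord d 1, ({u}ᶜ : Set (KautzWord d 1)).ncard = d := by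
    intro u
    have := Set.ncard_add_ncard_compl ({u} : Set (KautzWord d 1))
    rw [Set.ncard_singleton, card_kautzWord_one] at this
    omega
  have hout : ∀ z : CyclicKautzWord d 2, outDeg (cyclicKautz d 2) z = d := by
    intro z
    rw [outDeg_cyclicKautz le_rfl, outDeg]
    refine Eq.trans ?_ (hcompl z.suf)
    congr 1
    ext v
    exact subKautz_one_adj_iff.trans ne_comm
  have hin : ∀ z : CyclicKautzWord d 2, inDeg (cyclicKautz d 2) z = d := by
    intro z
    rw [inDeg_cyclicKautz le_rfl, inDeg]
    refine Eq.trans ?_ (hcompl z.pre)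
    congr 1
    ext v
    exact subKautz_one_adj_iff
  have := nontrivial_cyclicKautzWord hd (le_refl 1)
  have hmin : minDeg (cyclicKautz d 2) = d :=
    minDeg_eq (fun v => (hout v).ge) (fun v => (hin v).ge) ⟨Classical.arbitrary _, hout _⟩
  refine maximallyVertexConnected_of_forall (cyclicKautz_irrefl le_rfl) fun S hS hdis => ?_
  rcases hdis with hsc | hs
  swap
  · exact not_subsingleton_of_card_lt (cyclicKautz_irrefl le_rfl) hS hs
  obtain ⟨X, hX, hne, hne', -⟩ := exists_set_of_not_stronglyConnected_deleteVerts hsc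
  obtain ⟨P, hP, ⟨a, ha⟩, b, hb⟩ :=
    exists_arc_cut_of_vertex_cut le_rfl (fun u hu _ => hX u hu) hne hne'
  have hcard := Set.ncard_le_ncard_of_injOn (s := ({a}ᶜ : Set (KautzWord d 1)))
    (t := (S.image CyclicKautzWord.arc : Finset _))
    (fun c => if c ∈ P then (c, b) else (a, c))
    (fun c hc => by
      by_cases hcP : c ∈ P
      · simp only [if_pos hcP]
        exact hP c hcP b hb (subKautz_one_adj_iff.2 fun h => hb (h ▸ hcP))
      · simp only [if_neg hcP]
        exact hP a ha c hcP (subKautz_one_adj_iff.2 fun h => hcP (h ▸ ha)))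
    (fun c hc c' hc' h => by
      by_cases hcP : c ∈ P <;> by_cases hcP' : c' ∈ P <;>
        simp only [hcP, hcP', if_true, if_false, Prod.mk.injEq] at h
      · exact h.1
      · exact absurd h.1 hc
      · exact absurd h.1.symm hc'
      · exact h.2)
  rw [hcompl, Set.ncard_coe_finset] at hcard
  have := Finset.card_image_le (s := S) (f := CyclicKautzWord.arc)
  omega

/-! ### Arc-cuts of the cyclic Kautz digraph -/

/-- For `m ≥ 2` the second letter lies in both the prefix and the suffix, so either kind of trivial
cut fixes it. -/
theorem letter_one_eq (hm : 2 ≤ m) {S : Finset (CyclicKautzWord d (m + 1))}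
    (hS : ∃ p : KautzWord d m, p.free.card = d - 1 ∧
      ((S : Set (CyclicKautzWord d (m + 1))) = {z | z.pre = p} ∨
        (S : Set (CyclicKautzWord d (m + 1))) = {z | z.suf = p}))
    {z z' : CyclicKautzWord d (m + 1)} (hz : z ∈ S) (hz' : z' ∈ S) :
    z.1 ⟨1, by omega⟩ = z'.1 ⟨1, by omega⟩ := by
  rw [← Finset.mem_coe] at hz hz'
  obtain ⟨p, -, h | h⟩ := hS <;> rw [h] at hz hz'
  · exact congrFun (congrArg Subtype.val (hz.trans hz'.symm)) ⟨1, by omega⟩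
  · exact congrFun (congrArg Subtype.val (hz.trans hz'.symm)) ⟨0, by omega⟩

theorem letter_one_ne_of_adj (hm : 2 ≤ m) {z z' : CyclicKautzWord d (m + 1)}
    (h : (cyclicKautz d (m + 1)).Adj z z') : z.1 ⟨1, by omega⟩ ≠ z'.1 ⟨1, by omega⟩ := by
  rw [h.1 ⟨1, by omega⟩ ⟨2, by omega⟩ rfl]
  exact z.2.1 _ _ rfl

/-- The tails form a vertex cut and share their second letter. Exchanging one tail for its head
gives another cut, and a tail common to both makes the second letters of that arc's ends equal,
although adjacent words differ there. -/
theorem false_of_exists_not_tail (hd : 3 ≤ d) (hm : 2 ≤ m) {X : Set (CyclicKautzWord d (m + 1))}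
    {F : Finset (CyclicKautzWord d (m + 1) × CyclicKautzWord d (m + 1))} (hF : F.card ≤ d - 1)
    (hX : ∀ u ∈ X, ∀ v ∉ X, (cyclicKautz d (m + 1)).Adj u v → (u, v) ∈ F)
    (hF' : ∀ e ∈ F, e.1 ∈ X ∧ e.2 ∉ X ∧ (cyclicKautz d (m + 1)).Adj e.1 e.2)
    (hne : ∃ u ∈ X, ∀ e ∈ F, e.1 ≠ u) (hnt : Xᶜ.Nontrivial) : False := by
  classical
  obtain ⟨a, haX, ha⟩ := hne
  have haT : a ∉ F.image Prod.fst := by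
    intro h
    obtain ⟨e, he, rfl⟩ := Finset.mem_image.1 h
    exact ha e he rfl
  have hT : ∀ v ∉ X, v ∉ F.image Prod.fst := by
    intro v hv h
    obtain ⟨e, he, rfl⟩ := Finset.mem_image.1 h
    exact hv (hF' e he).1
  obtain ⟨b, hb, -⟩ := hnt.exists_ne a
  obtain ⟨hTcard, hTp⟩ := vertex_cut_cyclicKautz hd hm (S := F.image Prod.fst)
    (Finset.card_image_le.trans hF)
    (fun u hu huT v hv huv =>
      absurd (Finset.mem_image_of_mem Prod.fst (hX u hu v hv huv)) huT)
    ⟨a, haX, haT⟩ ⟨b, hb, hT b hb⟩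
  have hinj : Set.InjOn Prod.fst (F : Set (CyclicKautzWord d (m + 1) × CyclicKautzWord d (m + 1))) :=
    Finset.card_image_iff.1 (le_antisymm Finset.card_image_le (by omega))
  obtain ⟨t, ht, t', ht', htt⟩ := Finset.one_lt_card.1
    (show 1 < (F.image Prod.fst).card by omega)
  obtain ⟨e, he, rfl⟩ := Finset.mem_image.1 ht
  obtain ⟨heX, heX', hadj⟩ := hF' e he
  obtain ⟨c, hc, hce⟩ := hnt.exists_ne e.2
  have ht'2 : t' ∈ insert e.2 ((F.image Prod.fst).erase e.1) :=
    Finset.mem_insert_of_mem (Finset.mem_erase.2 ⟨htt.symm, ht'⟩)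
  obtain ⟨-, hSp⟩ := vertex_cut_cyclicKautz hd hm
    (S := insert e.2 ((F.image Prod.fst).erase e.1)) (X := X)
    (by
      have h1 := Finset.card_insert_le e.2 ((F.image Prod.fst).erase e.1)
      rw [Finset.card_erase_of_mem ht] at h1
      omega)
    -- The tails are distinct, so the only arc from `e.1` out of `X` ends at `e.2`, which is now
    -- deleted.
    (fun u hu huS v hv huv => by
      have huF := hX u hu v hv huv
      have hue : u = e.1 := by
        by_contra hue
        exact huS (Finset.mem_insert_of_mem
          (Finset.mem_erase.2 ⟨hue, Finset.mem_image_of_mem Prod.fst huF⟩))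
      rw [show v = e.2 from congrArg Prod.snd (hinj huF he hue)]
      exact Finset.mem_insert_self _ _)
    ⟨a, haX, fun h => by
      rcases Finset.mem_insert.1 h with h | h
      · exact heX' (h ▸ haX)
      · exact haT (Finset.mem_erase.1 h).2⟩
    ⟨c, hc, fun h => by
      rcases Finset.mem_insert.1 h with h | h
      · exact hce h
      · exact hT c hc (Finset.mem_erase.1 h).2⟩
  exact letter_one_ne_of_adj hm hadj ((letter_one_eq hm hTp ht ht').trans
    (letter_one_eq hm hSp ht'2 (Finset.mem_insert_self _ _)))

theorem false_of_exists_not_head (hd : 3 ≤ d) (hm : 2 ≤ m) {X : Set (CyclicKautzWord d (m + 1))}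
    {F : Finset (CyclicKautzWord d (m + 1) × CyclicKautzWord d (m + 1))} (hF : F.card ≤ d - 1)
    (hX : ∀ u ∈ X, ∀ v ∉ X, (cyclicKautz d (m + 1)).Adj u v → (u, v) ∈ F)
    (hF' : ∀ e ∈ F, e.1 ∈ X ∧ e.2 ∉ X ∧ (cyclicKautz d (m + 1)).Adj e.1 e.2)
    (hne : ∃ v ∉ X, ∀ e ∈ F, e.2 ≠ v) (hnt : X.Nontrivial) : False := by
  classical
  obtain ⟨a, haX, ha⟩ := hne
  have haT : a ∉ F.image Prod.snd := by
    intro h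
    obtain ⟨e, he, rfl⟩ := Finset.mem_image.1 h
    exact ha e he rfl
  have hT : ∀ v ∈ X, v ∉ F.image Prod.snd := by
    intro v hv h
    obtain ⟨e, he, rfl⟩ := Finset.mem_image.1 h
    exact (hF' e he).2.1 hv
  obtain ⟨b, hb, -⟩ := hnt.exists_ne a
  obtain ⟨hTcard, hTp⟩ := vertex_cut_cyclicKautz hd hm (S := F.image Prod.snd)
    (Finset.card_image_le.trans hF)
    (fun u hu _ v hv huv => Finset.mem_image_of_mem Prod.snd (hX u hu v hv huv))
    ⟨b, hb, hT b hb⟩ ⟨a, haX, haT⟩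
  have hinj : Set.InjOn Prod.snd (F : Set (CyclicKautzWord d (m + 1) × CyclicKautzWord d (m + 1))) :=
    Finset.card_image_iff.1 (le_antisymm Finset.card_image_le (by omega))
  obtain ⟨t, ht, t', ht', htt⟩ := Finset.one_lt_card.1
    (show 1 < (F.image Prod.snd).card by omega)
  obtain ⟨e, he, rfl⟩ := Finset.mem_image.1 ht
  obtain ⟨heX, heX', hadj⟩ := hF' e he
  obtain ⟨c, hc, hce⟩ := hnt.exists_ne e.1
  have ht'2 : t' ∈ insert e.1 ((F.image Prod.snd).erase e.2) :=
    Finset.mem_insert_of_mem (Finset.mem_erase.2 ⟨htt.symm, ht'⟩)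
  obtain ⟨-, hSp⟩ := vertex_cut_cyclicKautz hd hm
    (S := insert e.1 ((F.image Prod.snd).erase e.2)) (X := X)
    (by
      have h1 := Finset.card_insert_le e.1 ((F.image Prod.snd).erase e.2)
      rw [Finset.card_erase_of_mem ht] at h1
      omega)
    (fun u hu huS v hv huv => by
      have huF := hX u hu v hv huv
      refine Finset.mem_insert_of_mem
        (Finset.mem_erase.2 ⟨fun hve => ?_, Finset.mem_image_of_mem Prod.snd huF⟩)
      apply huS
      rw [show u = e.1 from congrArg Prod.fst (hinj huF he hve)]
      exact Finset.mem_insert_self _ _)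
    ⟨c, hc, fun h => by
      rcases Finset.mem_insert.1 h with h | h
      · exact hce h
      · exact hT c hc (Finset.mem_erase.1 h).2⟩
    ⟨a, haX, fun h => by
      rcases Finset.mem_insert.1 h with h | h
      · exact haX (h ▸ heX)
      · exact haT (Finset.mem_erase.1 h).2⟩
  exact letter_one_ne_of_adj hm hadj ((letter_one_eq hm hSp (Finset.mem_insert_self _ _) ht'2).trans
    (letter_one_eq hm hTp ht' ht))

theorem superLambda_cyclicKautz (hd : 3 ≤ d) (hm : 2 ≤ m) :
    SuperLambda (cyclicKautz d (m + 1)) := by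
  classical
  have hm1 : 1 ≤ m := by omega
  have hmin := minDeg_cyclicKautz (d := d) (by omega) hm
  have := nontrivial_cyclicKautzWord (d := d) (by omega) hm1
  refine superLambda_of_forall fun F hF hsc => ?_
  obtain ⟨X, hX, hne, hne'⟩ := exists_set_of_not_stronglyConnected hsc
  refine isTrivialArcSet_of_subsingleton (cyclicKautz_irrefl hm1) hF hX hne hne' ?_
  rw [hmin] at hF
  by_contra! hnt
  set F' := F.filter fun e => e.1 ∈ X ∧ e.2 ∉ X ∧ (cyclicKautz d (m + 1)).Adj e.1 e.2
  have hF' : F'.card ≤ d - 1 := (Finset.card_filter_le _ _).trans hF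
  have hXF' : ∀ u ∈ X, ∀ v ∉ X, (cyclicKautz d (m + 1)).Adj u v → (u, v) ∈ F' :=
    fun u hu v hv huv => Finset.mem_filter.2 ⟨hX u hu v hv huv, hu, hv, huv⟩
  -- The exchange arguments make every vertex of `X` a tail and every other vertex a head, so there
  -- are at most `2 * (d - 1)` vertices in all, too few.
  have h1 : X ⊆ (F'.image Prod.fst : Finset _) := by
    intro u hu
    by_contra hu'
    refine false_of_exists_not_tail hd hm hF' hXF' (fun e he => (Finset.mem_filter.1 he).2)
      ⟨u, hu, fun e he h => hu' ?_⟩ hnt.2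
    exact h ▸ Finset.mem_image_of_mem Prod.fst he
  have h2 : Xᶜ ⊆ (F'.image Prod.snd : Finset _) := by
    intro u hu
    by_contra hu'
    refine false_of_exists_not_head hd hm hF' hXF' (fun e he => (Finset.mem_filter.1 he).2)
      ⟨u, hu, fun e he h => hu' ?_⟩ hnt.1
    exact h ▸ Finset.mem_image_of_mem Prod.snd he
  have h3 := Set.ncard_le_ncard h1
  have h4 := Set.ncard_le_ncard h2
  rw [Set.ncard_coe_finset] at h3 h4
  have h5 := Finset.card_image_le (s := F') (f := Prod.fst)
  have h6 := Finset.card_image_le (s := F') (f := Prod.snd)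
  have h7 := Set.ncard_add_ncard_compl X
  have h8 := two_mul_le_card_cyclicKautzWord (d := d) (by omega) hm1
  omega

end KautzLike

theorem mainTheorem5 (d ℓ : ℕ) :
    (3 ≤ d → 2 ≤ ℓ → KautzLike.SuperLambda (KautzLike.subKautz d ℓ)) ∧
    ((d = 3 ∧ ℓ = 3) ∨ (4 ≤ d ∧ 3 ≤ ℓ) →
      KautzLike.MaximallyVertexConnected (KautzLike.subKautz d ℓ)) ∧
    (3 ≤ d → 3 ≤ ℓ → KautzLike.SuperLambda (KautzLike.cyclicKautz d ℓ)) ∧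
    ((d = 3 ∧ ℓ = 4) ∨ (4 ≤ d ∧ 4 ≤ ℓ) →
      KautzLike.SuperKappa (KautzLike.cyclicKautz d ℓ)) ∧
    ((d = 3 ∧ 2 ≤ ℓ ∧ ℓ ≠ 4) ∨ (4 ≤ d ∧ ℓ = 3) →
      KautzLike.MaximallyVertexConnected (KautzLike.cyclicKautz d ℓ)) := by
  refine ⟨KautzLike.superLambda_subKautz,
    fun h => KautzLike.maximallyVertexConnected_subKautz (by omega) (by omega),
    fun hd hℓ => ?_, fun h => ?_, fun h => ?_⟩
  · obtain ⟨m, rfl⟩ : ∃ m, ℓ = m + 1 := ⟨ℓ - 1, by omega⟩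
    exact KautzLike.superLambda_cyclicKautz hd (by omega)
  · obtain ⟨m, rfl⟩ : ∃ m, ℓ = m + 1 := ⟨ℓ - 1, by omega⟩
    exact KautzLike.superKappa_cyclicKautz (by omega) (by omega)
  · obtain ⟨m, rfl⟩ : ∃ m, ℓ = m + 1 := ⟨ℓ - 1, by omega⟩
    by_cases hm : m = 1
    · subst hm
      exact KautzLike.maximallyVertexConnected_cyclicKautz_two (by omega)
    · exact KautzLike.maximallyVertexConnected_cyclicKautz (by omega) (by omega)
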